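/- Let $\mathcal H$ be a finite-dimensional complex Hilbert space, $d=\dim\mathcal H$. A state is a positive semidefinite operator on $\mathcal H$ of trace $1$; $\tau=\mathbb 1/d$; $\|A\|_1=\operatorname{tr}|A|$; and $B_\varepsilon(\sigma)$ is the set of states $\omega$ with $\frac12\|\omega-\sigma\|_1\le\varepsilon$. For self-adjoint $A$, $\vec\lambda(A)\in\mathbb R^d$ is the vector of eigenvalues with multiplicity in non-increasing order. For states, $\rho\prec\omega$ means that $\vec\lambda(\rho)$ is majorized by $\vec\lambda(\omega)$: for $k=1,\dots,d-1$ the sum of the $k$ largest entries of $\vec\lambda(\rho)$ is at most that of $\vec\lambda(\omega)$, and the sums of all entries agree. The boundary of $B_\varepsilon(\sigma)$ is its relative boundary, i.e. its boundary within its affine hull. Let $\sigma=\sum_{i=1}^d\mu_i|i\rangle\langle i|$ be a state, with an orthonormal eigenbasis $(|i\rangle)$ and $\mu_1\ge\dots\ge\mu_d$. *Definition of $\rho^*_\varepsilon(\sigma)$ for $\varepsilon>0$.* If $\frac12\|\sigma-\tau\|_1\le\varepsilon$, put $\rho^*_\varepsilon(\sigma)=\tau$. Otherwise let $(\alpha_1,n)$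 and $(\alpha_2,m)$ be the pairs in $[0,1]\times\{1,\dots,d-1\}$ with $$\sum_{i=d-n+1}^d|\alpha_1-\mu_i|=\varepsilon,\quad \mu_{d-n+1}<\alpha_1\le\mu_{d-n},\qquad \sum_{i=1}^m|\alpha_2-\mu_i|=\varepsilon,\quad \mu_{m+1}\le\alpha_2<\mu_m,$$ and put $\rho^*_\varepsilon(\sigma)=\sum_{i\le m}\alpha_2|i\rangle\langle i|+\sum_{m<i\le d-n}\mu_i|i\rangle\langle i|+\sum_{i>d-n}\alpha_1|i\rangle\langle i|$. *Definition of $\rho_{*,\varepsilon}(\sigma)$ for $\varepsilon\in(0,1]$.* Let $Q_\ell$ be the sum of the $\ell$ smallest $\mu_i$ ($Q_0=0$) and let $\ell\in\{0,\dots,d-1\}$ be the largest index with $Q_\ell\le\varepsilon$. Put $\rho_{*,\varepsilon}(\sigma)=\sum_i p_i|i\rangle\langle i|$, where $p=(1,0,\dots,0)$ if $\ell=d-1$, and otherwise $$p_1=\mu_1+\varepsilon,\quad p_j=\mu_j\ (2\le j\le d-\ell-1),\quad p_{d-\ell}=\mu_{d-\ell}-(\varepsilon-Q_\ell),\quad p_j=0\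 (j>d-\ell).$$ **Theorem.** Let $\sigma$ be a state and $\varepsilon\in(0,1]$. If $\frac12\|\sigma-\tau\|_1>\varepsilon$, the pairs $(\alpha_1,n)$ and $(\alpha_2,m)$ above exist and are unique; $\rho^*_\varepsilon(\sigma)$ does not depend on the choice of the eigenbasis. For every choice of the eigenbasis the following hold. 1. $\rho^*_\varepsilon(\sigma)$ and $\rho_{*,\varepsilon}(\sigma)$ lie in $B_\varepsilon(\sigma)$, and $\rho^*_\varepsilon(\sigma)\prec\omega\prec\rho_{*,\varepsilon}(\sigma)$ for every $\omega\in B_\varepsilon(\sigma)$. 2. If $\rho\in B_\varepsilon(\sigma)$ satisfies $\rho\prec\omega$ for all $\omega\in B_\varepsilon(\sigma)$, then $\rho=\rho^*_\varepsilon(\sigma)$. If $\rho\in B_\varepsilon(\sigma)$ satisfies $\omega\prec\rho$ for all $\omega\in B_\varepsilon(\sigma)$, then $\rho=U\rho_{*,\varepsilon}(\sigma)U^*$ for some unitary $U$. 3. If $d\ge2$, then $\rho_{*,\varepsilon}(\sigma)$ lies on the boundary of $B_\varepsilon(\sigma)$. Moreover, $\frac12\|\rho_{*,\varepsilon}(\sigma)-\sigma\|_1=\varepsilon$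 or $\rho_{*,\varepsilon}(\sigma)$ is a pure state $|v\rangle\langle v|$ with $\|v\|=1$. 4. Either $\rho^*_\varepsilon(\sigma)=\tau$, or $\frac12\|\rho^*_\varepsilon(\sigma)-\sigma\|_1=\varepsilon$ and $\rho^*_\varepsilon(\sigma)$ lies on the boundary of $B_\varepsilon(\sigma)$. 5. For all $\varepsilon_1,\varepsilon_2\in(0,1]$, $\rho^*_{\varepsilon_1+\varepsilon_2}(\sigma)=\rho^*_{\varepsilon_1}(\rho^*_{\varepsilon_2}(\sigma))$. 6. $\frac12\|\sigma-\tau\|_1=\frac12\|\tau-\rho^*_\varepsilon(\sigma)\|_1+\frac12\|\rho^*_\varepsilon(\sigma)-\sigma\|_1$. -/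

import Mathlib

noncomputable section

/-! Vectors: non-increasing rearrangement and majorization. -/

/-- The non-increasing rearrangement `x↓` of a vector `x`. -/
def sortedDesc {d : ℕ} (x : Fin d → ℝ) : Fin d → ℝ :=
  x ∘ Tuple.sort (fun i => OrderDual.toDual (x i))

/-- `vecMajorizedBy x y` is `x ≺ y`: for `k = 1, …, d - 1` the sum of the `k` largest entries of
`x` is at most that of `y`, and the sums of all entries agree. -/
def vecMajorizedBy {d : ℕ} (x y : Fin d → ℝ) : Prop :=
  (∀ k : ℕ, 1 ≤ k → k < d →
    ∑ i with ((i : Fin d) : ℕ) < k, sortedDesc x i ≤ ∑ i with ((i : Fin d) : ℕ) < k, sortedDesc y i) ∧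
  ∑ i, sortedDesc x i = ∑ i, sortedDesc y i

/-! The two families of probability vectors. The entry `μ_j` (`1 ≤ j ≤ d`) is `μ i` with
`i = j - 1 : Fin d`. -/

/-- `(α₁, n) ∈ [0,1] × {1, …, d-1}` satisfies
`∑_{j = d-n+1}^{d} |α₁ - μ_j| = ε` and `μ_{d-n+1} < α₁ ≤ μ_{d-n}`. -/
def IsLowLevel {d : ℕ} (μ : Fin d → ℝ) (ε : ℝ) (a : ℝ × ℕ) : Prop :=
  0 ≤ a.1 ∧ a.1 ≤ 1 ∧ 1 ≤ a.2 ∧ a.2 < d ∧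
  ∑ i with d ≤ ((i : Fin d) : ℕ) + a.2, |a.1 - μ i| = ε ∧
  (∀ i : Fin d, (i : ℕ) + a.2 = d → μ i < a.1) ∧
  (∀ i : Fin d, (i : ℕ) + a.2 + 1 = d → a.1 ≤ μ i)

/-- `(α₂, m) ∈ [0,1] × {1, …, d-1}` satisfies
`∑_{j = 1}^{m} |α₂ - μ_j| = ε` and `μ_{m+1} ≤ α₂ < μ_m`. -/
def IsHighLevel {d : ℕ} (μ : Fin d → ℝ) (ε : ℝ) (a : ℝ × ℕ) : Prop :=
  0 ≤ a.1 ∧ a.1 ≤ 1 ∧ 1 ≤ a.2 ∧ a.2 < d ∧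
  ∑ i with ((i : Fin d) : ℕ) < a.2, |a.1 - μ i| = ε ∧
  (∀ i : Fin d, (i : ℕ) = a.2 → μ i ≤ a.1) ∧
  (∀ i : Fin d, (i : ℕ) + 1 = a.2 → a.1 < μ i)

/-- The pair `(α₁, n)`. -/
def lowLevel {d : ℕ} (μ : Fin d → ℝ) (ε : ℝ) : ℝ × ℕ :=
  Classical.epsilon (IsLowLevel μ ε)

/-- The pair `(α₂, m)`. -/
def highLevel {d : ℕ} (μ : Fin d → ℝ) (ε : ℝ) : ℝ × ℕ :=
  Classical.epsilon (IsHighLevel μ ε)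

/-- The vector with entries `α₂` on the first `m` indices, `α₁` on the last `n` indices, and `μ_j`
in between. -/
def flattenedVec {d : ℕ} (μ : Fin d → ℝ) (ε : ℝ) (i : Fin d) : ℝ :=
  if (i : ℕ) < (highLevel μ ε).2 then (highLevel μ ε).1
  else if d ≤ (i : ℕ) + (lowLevel μ ε).2 then (lowLevel μ ε).1
  else μ i

/-- `Q_ℓ`, the sum of the last `ℓ` entries of `q`. -/
def tailSum {d : ℕ} (q : Fin d → ℝ) (l : ℕ) : ℝ :=
  ∑ i with d ≤ ((i : Fin d) : ℕ) + l, q i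

open Classical in
/-- The largest `ℓ ∈ {0, …, d-1}` with `Q_ℓ ≤ ε` (for `ε ≥ 0`; note `Q_0 = 0`). For a
non-increasing `q` with nonnegative entries and `d ≥ 2`, `ℓ = 0` is the case `ε < q_d`. -/
def tailLength {d : ℕ} (q : Fin d → ℝ) (ε : ℝ) : ℕ :=
  Nat.findGreatest (fun l => tailSum q l ≤ ε) (d - 1)

/-- `p_{*,ε}(q)`: it is `(1, 0, …, 0)` if `ℓ = d - 1`, and otherwise
`(q_1 + ε, q_2, …, q_{d-ℓ-1}, q_{d-ℓ} - (ε - Q_ℓ), 0, …, 0)`. -/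
def spreadVec {d : ℕ} (q : Fin d → ℝ) (ε : ℝ) (i : Fin d) : ℝ :=
  if tailLength q ε = d - 1 then (if (i : ℕ) = 0 then 1 else 0)
  else if (i : ℕ) = 0 then q i + ε
  else if (i : ℕ) + tailLength q ε + 1 < d then q i
  else if (i : ℕ) + tailLength q ε + 1 = d then q i - (ε - tailSum q (tailLength q ε))
  else 0

/-! Operators on a finite-dimensional complex Hilbert space. -/

section Operators

variable {H : Type*} [NormedAddCommGroup H] [InnerProductSpace ℂ H] [FiniteDimensional ℂ H]

/-- A (quantum) state: a positive semidefinite operator of trace one. -/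
def IsQState (ρ : H →L[ℂ] H) : Prop :=
  ρ.IsPositive ∧ LinearMap.trace ℂ H (ρ : H →ₗ[ℂ] H) = 1

open Classical in
/-- The eigenvalues of a self-adjoint operator, with multiplicity, in non-increasing order
(zero by convention if `A` is not self-adjoint). -/
def eigVec (A : H →L[ℂ] H) : Fin (Module.finrank ℂ H) → ℝ :=
  if hA : (A : H →ₗ[ℂ] H).IsSymmetric then hA.eigenvalues rfl else 0

/-- `b` is an orthonormal basis of eigenvectors of `A`, ordered according to the non-increasing
order of the eigenvalues of `A`. -/
def IsSortedEigenbasis (A : H →L[ℂ] H)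
    (b : OrthonormalBasis (Fin (Module.finrank ℂ H)) ℂ H) : Prop :=
  ∀ i, A (b i) = ((eigVec A i : ℝ) : ℂ) • b i

open Classical in
/-- A choice of sorted eigenbasis of a self-adjoint operator (an arbitrary orthonormal basis by
convention if `A` is not self-adjoint). -/
def chosenEigenbasis (A : H →L[ℂ] H) : OrthonormalBasis (Fin (Module.finrank ℂ H)) ℂ H :=
  if hA : (A : H →ₗ[ℂ] H).IsSymmetric then hA.eigenvectorBasis rfl else stdOrthonormalBasis ℂ H

/-- The operator `∑_i p_i |b_i⟩⟨b_i|`. -/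
def diagOp (b : OrthonormalBasis (Fin (Module.finrank ℂ H)) ℂ H)
    (p : Fin (Module.finrank ℂ H) → ℝ) : H →L[ℂ] H :=
  ∑ i, ((p i : ℝ) : ℂ) • InnerProductSpace.rankOne ℂ (b i) (b i)

/-- `opMajorizedBy ρ σ` is `ρ ≺ σ`: majorization of the vectors of eigenvalues. -/
def opMajorizedBy (ρ σ : H →L[ℂ] H) : Prop :=
  vecMajorizedBy (eigVec ρ) (eigVec σ)

variable (H) in
/-- The completely mixed state `τ = 𝟙 / d`. -/
def mixedState : H →L[ℂ] H :=
  ((Module.finrank ℂ H : ℂ)⁻¹) • ContinuousLinearMap.id ℂ H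

variable [CompleteSpace H]

/-- The trace distance `½ ‖A - B‖₁`, where `‖X‖₁ = tr |X|` and `|X| = √(X† X)`. -/
def traceDist (A B : H →L[ℂ] H) : ℝ :=
  (1 / 2) * (LinearMap.trace ℂ H ((CFC.abs (A - B) : H →L[ℂ] H) : H →ₗ[ℂ] H)).re

/-- The ball `B_ε(σ)` of states at trace distance at most `ε` from `σ`. -/
def traceBall (ε : ℝ) (σ : H →L[ℂ] H) : Set (H →L[ℂ] H) :=
  {ω | IsQState ω ∧ traceDist ω σ ≤ ε}

open Classical in
/-- `ρ*_ε(σ)`, written in the sorted eigenbasis `b` of `σ`. -/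
def minStateIn (ε : ℝ) (σ : H →L[ℂ] H)
    (b : OrthonormalBasis (Fin (Module.finrank ℂ H)) ℂ H) : H →L[ℂ] H :=
  if ε < traceDist σ (mixedState H) then diagOp b (flattenedVec (eigVec σ) ε) else mixedState H

/-- The map `σ ↦ ρ*_ε(σ)`. -/
def minState (ε : ℝ) (σ : H →L[ℂ] H) : H →L[ℂ] H :=
  minStateIn ε σ (chosenEigenbasis σ)

/-- `ρ_{*,ε}(σ)`, written in the sorted eigenbasis `b` of `σ`. It depends on `b`, but only up to a
unitary conjugation. -/
def maxStateIn (ε : ℝ) (σ : H →L[ℂ] H)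
    (b : OrthonormalBasis (Fin (Module.finrank ℂ H)) ℂ H) : H →L[ℂ] H :=
  diagOp b (spreadVec (eigVec σ) ε)

end Operators

end

open Finset

set_option linter.unusedSectionVars false

noncomputable section

/-! Prefix sums of non-increasing vectors. -/

/-! Everything reduces to vectors of ordered eigenvalues. If `A` and `B` are states, `A - B` is
traceless, so a partial sum of its diagonal in any orthonormal basis is at most half its trace norm.
With Ky Fan's principle (`sum_prefix_inner_diagOp_le`) this gives `sum_prefix_eigVec_sub_le`: for
`ω` in the ball, each prefix sum of its ordered eigenvalues is within `ε` of the corresponding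
prefix sum `S_k` of `μ = eigVec σ`.

The extremal vectors saturate these bounds. Each nonempty prefix sum of `spreadVec μ ε` is either
the trivial maximum `1` or `S_k + ε` (`spreadVec_facts`). The vector `flattenedVec μ ε` is `μ`
clipped to `[α₁, α₂]` (`exists_flattenedVec_eq`). Its prefix sums equal `S_k - ε` in the middle
range, and on the two end blocks, where it is constant, monotonicity of the competitor suffices
(`sum_prefix_clip_le`). If `ε` reaches the distance to `τ`, the constant vector is minimal.

Mutual majorization forces equal spectra. This settles uniqueness of the maximum up to a unitary.
For the minimum, the ball is convex, and the midpoint of two distinct operators of equal spectrum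
has a strictly smaller Hilbert-Schmidt norm, against Schur convexity of the sum of squares
(`eq_of_eigVec_eq_of_opMajorizedBy`).

A point at distance `ε` is on the boundary because the segment from `σ` cannot be prolonged past it.
A singular state is on the boundary because a segment from a positive definite point of the ball
cannot be prolonged past it. The semigroup law holds because successive clippings compose and their
deficits add. The triangle equality holds because each clipped entry lies between `1/d` and the
original entry. -/

lemma sortedDesc_of_antitone {d : ℕ} {x : Fin d → ℝ} (hx : Antitone x) : sortedDesc x = x := by
  have h : Tuple.sort (fun i => OrderDual.toDual (x i)) = Equiv.refl _ :=
    Tuple.sort_eq_refl_iff_monotone.2 fun i j hij => OrderDual.toDual_le_toDual.2 (hx hij)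
  unfold sortedDesc
  rw [h]
  rfl

lemma sum_prefix_eq_sum {d : ℕ} (x : Fin d → ℝ) {k : ℕ} (hk : d ≤ k) :
    ∑ i with ((i : Fin d) : ℕ) < k, x i = ∑ i, x i := by
  rw [Finset.filter_true_of_mem fun i _ => i.2.trans_le hk]

lemma vecMajorizedBy_iff_of_antitone {d : ℕ} {x y : Fin d → ℝ} (hx : Antitone x)
    (hy : Antitone y) :
    vecMajorizedBy x y ↔
      (∀ k : ℕ, ∑ i with ((i : Fin d) : ℕ) < k, x i ≤ ∑ i with ((i : Fin d) : ℕ) < k, y i) ∧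
        ∑ i, x i = ∑ i, y i := by
  unfold vecMajorizedBy
  rw [sortedDesc_of_antitone hx, sortedDesc_of_antitone hy]
  refine ⟨fun ⟨h, hs⟩ => ⟨fun k => ?_, hs⟩, fun ⟨h, hs⟩ => ⟨fun k _ _ => h k, hs⟩⟩
  rcases Nat.eq_zero_or_pos k with rfl | hk
  · simp
  rcases lt_or_ge k d with hkd | hkd
  · exact h k hk hkd
  · rw [sum_prefix_eq_sum x hkd, sum_prefix_eq_sum y hkd, hs]

lemma sum_prefix_succ {d : ℕ} (x : Fin d → ℝ) (j : Fin d) :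
    ∑ i with ((i : Fin d) : ℕ) < (j : ℕ) + 1, x i =
      x j + ∑ i with ((i : Fin d) : ℕ) < (j : ℕ), x i := by
  have : (univ.filter fun i : Fin d => (i : ℕ) < (j : ℕ) + 1) =
      insert j (univ.filter fun i : Fin d => (i : ℕ) < (j : ℕ)) := by
    ext i
    simp only [mem_filter, mem_univ, true_and, mem_insert, Fin.ext_iff]
    omega
  rw [this, sum_insert (by simp)]

lemma eq_of_sum_prefix_eq {d : ℕ} {x y : Fin d → ℝ}
    (h : ∀ k : ℕ, ∑ i with ((i : Fin d) : ℕ) < k, x i = ∑ i with ((i : Fin d) : ℕ) < k, y i) :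
    x = y := by
  ext j
  have h1 := h ((j : ℕ) + 1)
  rw [sum_prefix_succ, sum_prefix_succ, h j] at h1
  linarith

/-- A prefix sum of `x - y` is nonnegative at an index `k` if it is so at indices `r ≤ k ≤ s` and
`y` is constant on `[r, s)`. -/
lemma sum_prefix_sub_nonneg_of_block {d : ℕ} {x y : Fin d → ℝ} (hx : Antitone x) {a : ℝ}
    {r k s : ℕ} (hrk : r ≤ k) (hks : k ≤ s)
    (hy : ∀ i : Fin d, r ≤ (i : ℕ) → (i : ℕ) < s → y i = a)
    (hr : 0 ≤ ∑ i with ((i : Fin d) : ℕ) < r, (x i - y i))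
    (hs : 0 ≤ ∑ i with ((i : Fin d) : ℕ) < s, (x i - y i)) :
    0 ≤ ∑ i with ((i : Fin d) : ℕ) < k, (x i - y i) := by
  -- Either the terms from `r` to `k` are all nonnegative and the sum up to `k` dominates the one up
  -- to `r`, or `x` has dropped below `a` before `k`; then the terms from `k` to `s` are negative
  -- and the sum dominates the one up to `s`.
  by_cases h : ∀ i : Fin d, r ≤ (i : ℕ) → (i : ℕ) < k → a ≤ x i
  · refine hr.trans ?_
    rw [sum_filter, sum_filter]
    refine sum_le_sum fun i _ => ?_
    split_ifs with h1 h2 h2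
    · exact le_rfl
    · omega
    · have := h i (by omega) h2
      rw [hy i (by omega) (by omega)]
      linarith
    · exact le_rfl
  · push Not at h
    obtain ⟨i, hi1, hi2, hi3⟩ := h
    refine hs.trans ?_
    rw [sum_filter, sum_filter]
    refine sum_le_sum fun j _ => ?_
    split_ifs with h1 h2 h2
    · exact le_rfl
    · have : x j ≤ x i := hx (Fin.le_def.2 (by omega))
      rw [hy j (by omega) (by omega)]
      linarith
    · omega
    · exact le_rfl

/-- A weighted sum of a non-increasing vector with weights in `[0, 1]` of total weight `k` is at
most the sum of the first `k` entries. -/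
lemma sum_mul_le_sum_prefix {d : ℕ} {x w : Fin d → ℝ} (hx : Antitone x) (hw0 : ∀ i, 0 ≤ w i)
    (hw1 : ∀ i, w i ≤ 1) {k : ℕ} (hk : k ≤ d) (hw : ∑ i, w i = k) :
    ∑ i, x i * w i ≤ ∑ i with ((i : Fin d) : ℕ) < k, x i := by
  -- A threshold separating the first `k` entries from the rest. Subtracting it costs nothing
  -- because both weight vectors have total `k`, and then every summand in `key` is a product of
  -- factors of equal sign.
  obtain ⟨c, hc1, hc2⟩ : ∃ c, (∀ i : Fin d, (i : ℕ) < k → c ≤ x i) ∧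
      ∀ i : Fin d, k ≤ (i : ℕ) → x i ≤ c := by
    rcases hk.lt_or_eq with hk | rfl
    · exact ⟨x ⟨k, hk⟩, fun i hi => hx (Fin.le_def.2 hi.le), fun i hi => hx (Fin.le_def.2 hi)⟩
    · rcases Nat.eq_zero_or_pos k with rfl | h0
      · exact ⟨0, fun i => i.elim0, fun i => i.elim0⟩
      · exact ⟨x ⟨k - 1, by omega⟩, fun i hi => hx (Fin.le_def.2 (by simp; omega)),
          fun i hi => absurd i.2 (by omega)⟩
  have hcard : ∑ i : Fin d, (if (i : ℕ) < k then (1 : ℝ) else 0) = k := by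
    rw [← sum_filter, sum_const, Fin.card_filter_val_lt, min_eq_right hk]
    simp
  have key : 0 ≤ ∑ i, (x i - c) * ((if (i : ℕ) < k then (1 : ℝ) else 0) - w i) := by
    refine sum_nonneg fun i _ => ?_
    split_ifs with h
    · exact mul_nonneg (by linarith [hc1 i h]) (by linarith [hw1 i])
    · exact mul_nonneg_of_nonpos_of_nonpos (by linarith [hc2 i (by omega)]) (by linarith [hw0 i])
  have expand : ∑ i, (x i - c) * ((if (i : ℕ) < k then (1 : ℝ) else 0) - w i) =
      ∑ i : Fin d, (if (i : ℕ) < k then x i else 0) - ∑ i, x i * w i -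
        c * (∑ i : Fin d, (if (i : ℕ) < k then (1 : ℝ) else 0) - ∑ i, w i) := by
    rw [← sum_sub_distrib, ← sum_sub_distrib, mul_sum, ← sum_sub_distrib]
    refine sum_congr rfl fun i _ => ?_
    split_ifs <;> ring
  rw [expand, hcard, hw] at key
  rw [sum_filter]
  linarith

/-- Abel summation: if the prefix sums of `z` are nonnegative with total zero, then pairing `z`
with a non-increasing vector is nonnegative. -/
lemma sum_mul_nonneg_of_sum_prefix_nonneg {d : ℕ} {x z : Fin d → ℝ} (hx : Antitone x)
    (hz : ∀ k : ℕ, 0 ≤ ∑ i with ((i : Fin d) : ℕ) < k, z i) (hz0 : ∑ i, z i = 0) :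
    0 ≤ ∑ i, x i * z i := by
  -- The induction is on partial sums; at the last index the left side vanishes because `z` has
  -- total zero.
  suffices H : ∀ k (hk : k < d), x ⟨k, hk⟩ * ∑ i with ((i : Fin d) : ℕ) < k + 1, z i ≤
      ∑ i with ((i : Fin d) : ℕ) < k + 1, x i * z i by
    rcases Nat.eq_zero_or_pos d with rfl | hd
    · simp
    · have := H (d - 1) (by omega)
      rwa [sum_prefix_eq_sum _ (by omega), sum_prefix_eq_sum _ (by omega), hz0, mul_zero] at this
  intro k
  induction k with
  | zero =>
    intro hk
    have h1 := sum_prefix_succ z ⟨0, hk⟩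
    have h2 := sum_prefix_succ (fun i => x i * z i) ⟨0, hk⟩
    simp only [Nat.not_lt_zero, filter_false, sum_empty, add_zero] at h1 h2
    rw [h1, h2]
  | succ k ih =>
    intro hk
    have h1 := sum_prefix_succ z ⟨k + 1, hk⟩
    have h2 := sum_prefix_succ (fun i => x i * z i) ⟨k + 1, hk⟩
    simp only at h1 h2
    rw [h1, h2, mul_add]
    have h3 := ih (by omega)
    have h4 : x ⟨k + 1, hk⟩ ≤ x ⟨k, by omega⟩ := hx (Fin.le_def.2 (by simp))
    have := mul_le_mul_of_nonneg_right h4 (hz (k + 1))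
    linarith

/-- Schur convexity of the sum of squares: expand `y = x + (y - x)`. The cross term is nonnegative
by Abel summation. -/
lemma sum_sq_le_of_sum_prefix_le {d : ℕ} {x y : Fin d → ℝ} (hx : Antitone x)
    (h : ∀ k : ℕ, ∑ i with ((i : Fin d) : ℕ) < k, x i ≤ ∑ i with ((i : Fin d) : ℕ) < k, y i)
    (hs : ∑ i, x i = ∑ i, y i) : ∑ i, x i ^ 2 ≤ ∑ i, y i ^ 2 := by
  have key := sum_mul_nonneg_of_sum_prefix_nonneg (z := fun i => y i - x i) hx
    (fun k => by rw [sum_sub_distrib]; linarith [h k]) (by rw [sum_sub_distrib]; linarith)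
  have h2 : 0 ≤ ∑ i, (y i - x i) ^ 2 := sum_nonneg fun i _ => sq_nonneg _
  have h3 : ∑ i, y i ^ 2 = ∑ i, x i ^ 2 + 2 * ∑ i, x i * (y i - x i) + ∑ i, (y i - x i) ^ 2 := by
    rw [mul_sum, ← sum_add_distrib, ← sum_add_distrib]
    exact sum_congr rfl fun i _ => by ring
  linarith

/-- The constant vector is majorized by every non-increasing vector with the same sum. -/
lemma sum_prefix_const_le {d : ℕ} {x : Fin d → ℝ} (hx : Antitone x) {t : ℝ}
    (hs : ∑ i, x i = ∑ _i : Fin d, t) (k : ℕ) :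
    ∑ i with ((i : Fin d) : ℕ) < k, t ≤ ∑ i with ((i : Fin d) : ℕ) < k, x i := by
  rcases le_or_gt k d with hk | hk
  · have := sum_prefix_sub_nonneg_of_block (y := fun _ => t) hx (Nat.zero_le k) hk
      (fun _ _ _ => rfl) (by simp)
      (by rw [sum_prefix_eq_sum _ le_rfl, sum_sub_distrib, hs, sub_self])
    rw [sum_sub_distrib] at this
    linarith
  · rw [sum_prefix_eq_sum _ hk.le, sum_prefix_eq_sum _ hk.le, hs]

/-! Clipping a vector from below and from above. -/

/-- The total amount by which `x` lies below the level `a`. -/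
def deficit {d : ℕ} (x : Fin d → ℝ) (a : ℝ) : ℝ := ∑ i, max (a - x i) 0

/-- The total amount by which `x` lies above the level `a`. -/
def excess {d : ℕ} (x : Fin d → ℝ) (a : ℝ) : ℝ := ∑ i, max (x i - a) 0

lemma excess_eq_deficit_add {d : ℕ} (x : Fin d → ℝ) (a : ℝ) :
    excess x a = deficit x a + (∑ i, x i - ∑ _i : Fin d, a) := by
  unfold excess deficit
  rw [← sum_sub_distrib, ← sum_add_distrib]
  refine sum_congr rfl fun i _ => ?_
  rcases le_total (x i) a with h | h
  · rw [max_eq_right (by linarith), max_eq_left (by linarith)]; ring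
  · rw [max_eq_left (by linarith), max_eq_right (by linarith)]; ring

lemma sum_abs_sub_const {d : ℕ} (x : Fin d → ℝ) (a : ℝ) :
    ∑ i, |x i - a| = deficit x a + excess x a := by
  unfold excess deficit
  rw [← sum_add_distrib]
  refine sum_congr rfl fun i _ => ?_
  rcases le_total (x i) a with h | h
  · rw [max_eq_right (a := x i - a) (by linarith), max_eq_left (by linarith),
      abs_of_nonpos (by linarith)]; ring
  · rw [max_eq_left (a := x i - a) (by linarith), max_eq_right (by linarith),
      abs_of_nonneg (by linarith)]; ring

lemma deficit_mono {d : ℕ} (x : Fin d → ℝ) : Monotone (deficit x) := fun _ _ h =>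
  sum_le_sum fun _ _ => max_le_max (by linarith) le_rfl

lemma excess_anti {d : ℕ} (x : Fin d → ℝ) : Antitone (excess x) := fun _ _ h =>
  sum_le_sum fun _ _ => max_le_max (by linarith) le_rfl

lemma exists_lt_of_deficit_pos {d : ℕ} {x : Fin d → ℝ} {a : ℝ} (h : 0 < deficit x a) :
    ∃ i, x i < a := by
  by_contra! hc
  exact h.ne' (sum_eq_zero fun i _ => max_eq_right (by linarith [hc i]))

lemma exists_gt_of_excess_pos {d : ℕ} {x : Fin d → ℝ} {a : ℝ} (h : 0 < excess x a) :
    ∃ i, a < x i := by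
  by_contra! hc
  exact h.ne' (sum_eq_zero fun i _ => max_eq_right (by linarith [hc i]))

lemma deficit_lt_of_lt {d : ℕ} {x : Fin d → ℝ} {a b : ℝ} (ha : 0 < deficit x a) (h : a < b) :
    deficit x a < deficit x b := by
  obtain ⟨i, hi⟩ := exists_lt_of_deficit_pos ha
  refine sum_lt_sum (fun j _ => max_le_max (by linarith) le_rfl) ⟨i, mem_univ _, ?_⟩
  rw [max_eq_left (by linarith), max_eq_left (by linarith)]
  linarith

lemma excess_lt_of_lt {d : ℕ} {x : Fin d → ℝ} {a b : ℝ} (ha : 0 < excess x a) (h : b < a) :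
    excess x a < excess x b := by
  obtain ⟨i, hi⟩ := exists_gt_of_excess_pos ha
  refine sum_lt_sum (fun j _ => max_le_max (by linarith) le_rfl) ⟨i, mem_univ _, ?_⟩
  rw [max_eq_left (by linarith), max_eq_left (by linarith)]
  linarith

lemma eq_of_deficit_eq {d : ℕ} {x : Fin d → ℝ} {a b : ℝ} (ha : 0 < deficit x a)
    (h : deficit x a = deficit x b) : a = b := by
  rcases lt_trichotomy a b with hab | hab | hab
  · exact absurd h (deficit_lt_of_lt ha hab).ne
  · exact hab
  · exact absurd h (deficit_lt_of_lt (h ▸ ha) hab).ne'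

lemma eq_of_excess_eq {d : ℕ} {x : Fin d → ℝ} {a b : ℝ} (ha : 0 < excess x a)
    (h : excess x a = excess x b) : a = b := by
  rcases lt_trichotomy a b with hab | hab | hab
  · exact absurd h (excess_lt_of_lt (h ▸ ha) hab).ne'
  · exact hab
  · exact absurd h (excess_lt_of_lt ha hab).ne

lemma continuous_deficit {d : ℕ} (x : Fin d → ℝ) : Continuous (deficit x) := by
  unfold deficit
  fun_prop

lemma continuous_excess {d : ℕ} (x : Fin d → ℝ) : Continuous (excess x) := by
  unfold excess
  fun_prop

/-! ### The levels `α₁` and `α₂`, and flattening as clipping. -/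

/-- For a non-increasing `μ` the two inequalities at the cut say that the last `n` indices are
exactly those with `μ i < a`. The sum then no longer mentions `n`: it is `deficit μ a`, which is
continuous in `a` and strictly increasing where positive. -/
lemma isLowLevel_iff {d : ℕ} {μ : Fin d → ℝ} (hμ : Antitone μ) {ε a : ℝ} {n : ℕ} :
    IsLowLevel μ ε (a, n) ↔ 0 ≤ a ∧ a ≤ 1 ∧ 1 ≤ n ∧ n < d ∧ deficit μ a = ε ∧
      ∀ i : Fin d, μ i < a ↔ d ≤ (i : ℕ) + n := by
  have sum_eq : (∀ i : Fin d, μ i < a ↔ d ≤ (i : ℕ) + n) →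
      ∑ i with d ≤ ((i : Fin d) : ℕ) + n, |a - μ i| = deficit μ a := by
    intro h
    unfold deficit
    rw [sum_filter]
    refine sum_congr rfl fun i _ => ?_
    split_ifs with hi
    · have := (h i).2 hi
      rw [abs_of_nonneg (by linarith), max_eq_left (by linarith)]
    · have := mt (h i).1 hi
      rw [max_eq_right (by linarith)]
  unfold IsLowLevel
  simp only
  constructor
  · rintro ⟨h0, h1, hn, hnd, hs, hlt, hle⟩
    have key : ∀ i : Fin d, μ i < a ↔ d ≤ (i : ℕ) + n := by
      intro i
      constructor
      · intro hi
        by_contra hc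
        have h2 := hle ⟨d - n - 1, by omega⟩ (by simp; omega)
        have h3 : μ ⟨d - n - 1, by omega⟩ ≤ μ i := hμ (Fin.le_def.2 (by simp; omega))
        linarith
      · intro hi
        have h2 := hlt ⟨d - n, by omega⟩ (by simp; omega)
        have h3 : μ i ≤ μ ⟨d - n, by omega⟩ := hμ (Fin.le_def.2 (by simp; omega))
        linarith
    exact ⟨h0, h1, hn, hnd, (sum_eq key).symm.trans hs, key⟩
  · rintro ⟨h0, h1, hn, hnd, hs, key⟩
    exact ⟨h0, h1, hn, hnd, (sum_eq key).trans hs, fun i hi => (key i).2 hi.ge,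
      fun i hi => not_lt.1 (mt (key i).1 (by omega))⟩

lemma isHighLevel_iff {d : ℕ} {μ : Fin d → ℝ} (hμ : Antitone μ) {ε a : ℝ} {m : ℕ} :
    IsHighLevel μ ε (a, m) ↔ 0 ≤ a ∧ a ≤ 1 ∧ 1 ≤ m ∧ m < d ∧ excess μ a = ε ∧
      ∀ i : Fin d, a < μ i ↔ (i : ℕ) < m := by
  have sum_eq : (∀ i : Fin d, a < μ i ↔ (i : ℕ) < m) →
      ∑ i with ((i : Fin d) : ℕ) < m, |a - μ i| = excess μ a := by
    intro h
    unfold excess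
    rw [sum_filter]
    refine sum_congr rfl fun i _ => ?_
    split_ifs with hi
    · have := (h i).2 hi
      rw [abs_of_nonpos (by linarith), max_eq_left (by linarith)]
      ring
    · have := mt (h i).1 hi
      rw [max_eq_right (by linarith)]
  unfold IsHighLevel
  simp only
  constructor
  · rintro ⟨h0, h1, hn, hnd, hs, hle, hlt⟩
    have key : ∀ i : Fin d, a < μ i ↔ (i : ℕ) < m := by
      intro i
      constructor
      · intro hi
        by_contra hc
        have h2 := hle ⟨m, hnd⟩ rfl
        have h3 : μ i ≤ μ ⟨m, hnd⟩ := hμ (Fin.le_def.2 (by simp; omega))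
        linarith
      · intro hi
        have h2 := hlt ⟨m - 1, by omega⟩ (by simp; omega)
        have h3 : μ ⟨m - 1, by omega⟩ ≤ μ i := hμ (Fin.le_def.2 (by simp; omega))
        linarith
    exact ⟨h0, h1, hn, hnd, (sum_eq key).symm.trans hs, key⟩
  · rintro ⟨h0, h1, hn, hnd, hs, key⟩
    exact ⟨h0, h1, hn, hnd, (sum_eq key).trans hs,
      fun i hi => not_lt.1 (mt (key i).1 (by omega)), fun i hi => (key i).2 (by omega)⟩

/-- Some entry of a vector is at least its average. -/
lemma exists_ge_of_sum_eq {d : ℕ} (hd : 0 < d) {μ : Fin d → ℝ} (hs : ∑ i, μ i = 1) :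
    ∃ i, (d : ℝ)⁻¹ ≤ μ i := by
  by_contra! hc
  have : ∑ i, μ i < ∑ _i : Fin d, (d : ℝ)⁻¹ :=
    sum_lt_sum_of_nonempty ⟨⟨0, hd⟩, mem_univ _⟩ fun i _ => hc i
  rw [hs, sum_const, card_univ, Fintype.card_fin, nsmul_eq_mul,
    mul_inv_cancel₀ (by exact_mod_cast hd.ne')] at this
  exact lt_irrefl _ this

/-- Some entry of a vector is at most its average. -/
lemma exists_le_of_sum_eq {d : ℕ} (hd : 0 < d) {μ : Fin d → ℝ} (hs : ∑ i, μ i = 1) :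
    ∃ i, μ i ≤ (d : ℝ)⁻¹ := by
  by_contra! hc
  have : ∑ _i : Fin d, (d : ℝ)⁻¹ < ∑ i, μ i :=
    sum_lt_sum_of_nonempty ⟨⟨0, hd⟩, mem_univ _⟩ fun i _ => hc i
  rw [hs, sum_const, card_univ, Fintype.card_fin, nsmul_eq_mul,
    mul_inv_cancel₀ (by exact_mod_cast hd.ne')] at this
  exact lt_irrefl _ this

lemma pos_of_sum_eq_one {d : ℕ} {μ : Fin d → ℝ} (hs : ∑ i, μ i = 1) : 0 < d := by
  rcases Nat.eq_zero_or_pos d with rfl | h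
  · simp at hs
  · exact h

lemma sum_inv_card {d : ℕ} (hd : 0 < d) : ∑ _i : Fin d, (d : ℝ)⁻¹ = 1 := by
  rw [sum_const, card_univ, Fintype.card_fin, nsmul_eq_mul,
    mul_inv_cancel₀ (by exact_mod_cast hd.ne')]

lemma excess_inv_card {d : ℕ} {μ : Fin d → ℝ} (hs : ∑ i, μ i = 1) :
    excess μ (d : ℝ)⁻¹ = deficit μ (d : ℝ)⁻¹ := by
  rw [excess_eq_deficit_add, hs, sum_inv_card (pos_of_sum_eq_one hs), sub_self, add_zero]

/-- The level comes from the intermediate value theorem on `[0, 1/d]` and is unique by strict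
monotonicity; `n` is the number of entries below it. A positive deficit gives `1 ≤ n`, and an entry
that is at least the average gives `n < d`. -/
lemma existsUnique_isLowLevel {d : ℕ} {μ : Fin d → ℝ} (hμ : Antitone μ) (h0 : ∀ i, 0 ≤ μ i)
    (hs : ∑ i, μ i = 1) {ε : ℝ} (hε : 0 < ε) (hlt : ε < deficit μ (d : ℝ)⁻¹) :
    ∃! a : ℝ × ℕ, IsLowLevel μ ε a := by
  have hd := pos_of_sum_eq_one hs
  have ht0 : (0 : ℝ) ≤ (d : ℝ)⁻¹ := by positivity
  have ht1 : (d : ℝ)⁻¹ ≤ 1 := inv_le_one_of_one_le₀ (by exact_mod_cast hd)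
  have hz : deficit μ 0 = 0 := sum_eq_zero fun i _ => max_eq_right (by linarith [h0 i])
  obtain ⟨a, ⟨ha0, ha1⟩, ha⟩ := intermediate_value_Icc ht0 (continuous_deficit μ).continuousOn
    (show ε ∈ Set.Icc _ _ from ⟨by rw [hz]; exact hε.le, hlt.le⟩)
  have hcount := fun j => Tuple.lt_card_ge_iff_apply_ge_of_antitone (j := j) (a := a) hμ
  set c := #{i | a ≤ μ i} with hc
  have hcd : c ≤ d := (card_le_univ _).trans_eq (Fintype.card_fin d)
  have key : ∀ i : Fin d, μ i < a ↔ d ≤ (i : ℕ) + (d - c) := by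
    intro i
    rw [← not_le, ← hcount i]
    have := i.2
    omega
  obtain ⟨i, hi⟩ := exists_lt_of_deficit_pos (ha ▸ hε)
  obtain ⟨j, hj⟩ := exists_ge_of_sum_eq hd hs
  have hi' := (key i).1 hi
  have hj' := mt (key j).2 (by linarith)
  have := i.2
  refine ⟨(a, d - c), (isLowLevel_iff hμ).2 ⟨ha0, ha1.trans ht1, by omega, by omega, ha, key⟩, ?_⟩
  rintro ⟨a', n⟩ h
  obtain ⟨-, -, hn1, hnd, ha', key'⟩ := (isLowLevel_iff hμ).1 h
  obtain rfl : a' = a := eq_of_deficit_eq (ha' ▸ hε) (ha'.trans ha.symm)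
  -- Both counts cut out the same final segment of indices; comparing the first index of each
  -- segment gives equality.
  have k1 := (key ⟨d - n, by omega⟩).1 ((key' ⟨d - n, by omega⟩).2 (by simp; omega))
  have k2 := (key' ⟨d - (d - c), by omega⟩).1 ((key ⟨d - (d - c), by omega⟩).2 (by simp))
  simp only at k1 k2
  rw [Prod.mk.injEq]
  exact ⟨rfl, by omega⟩

lemma existsUnique_isHighLevel {d : ℕ} {μ : Fin d → ℝ} (hμ : Antitone μ) (h0 : ∀ i, 0 ≤ μ i)
    (hs : ∑ i, μ i = 1) {ε : ℝ} (hε : 0 < ε) (hlt : ε < deficit μ (d : ℝ)⁻¹) :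
    ∃! a : ℝ × ℕ, IsHighLevel μ ε a := by
  have hd := pos_of_sum_eq_one hs
  have ht0 : (0 : ℝ) ≤ (d : ℝ)⁻¹ := by positivity
  have ht1 : (d : ℝ)⁻¹ ≤ 1 := inv_le_one_of_one_le₀ (by exact_mod_cast hd)
  have hz : excess μ 1 = 0 := sum_eq_zero fun i _ => max_eq_right (by
    have := single_le_sum (fun i _ => h0 i) (mem_univ i)
    linarith)
  obtain ⟨a, ⟨ha0, ha1⟩, ha⟩ := intermediate_value_Icc' ht1 (continuous_excess μ).continuousOn
    (show ε ∈ Set.Icc _ _ from ⟨by rw [hz]; exact hε.le, by rw [excess_inv_card hs]; exact hlt.le⟩)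
  have hcount := fun j => Tuple.lt_card_gt_iff_apply_gt_of_antitone (j := j) (a := a) hμ
  set c := #{i | a < μ i} with hc
  have hcd : c ≤ d := (card_le_univ _).trans_eq (Fintype.card_fin d)
  have key : ∀ i : Fin d, a < μ i ↔ (i : ℕ) < c := fun i => (hcount i).symm
  obtain ⟨i, hi⟩ := exists_gt_of_excess_pos (ha ▸ hε)
  obtain ⟨j, hj⟩ := exists_le_of_sum_eq hd hs
  have hi' := (key i).1 hi
  have hj' := mt (key j).2 (by linarith)
  have := j.2
  refine ⟨(a, c), (isHighLevel_iff hμ).2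
    ⟨ht0.trans ha0, ha1, by omega, by omega, ha, key⟩, ?_⟩
  rintro ⟨a', n⟩ h
  obtain ⟨-, -, hn1, hnd, ha', key'⟩ := (isHighLevel_iff hμ).1 h
  obtain rfl : a' = a := eq_of_excess_eq (ha' ▸ hε) (ha'.trans ha.symm)
  have k1 := mt (key' ⟨c, by omega⟩).2 (mt (key ⟨c, by omega⟩).1 (by simp))
  have k2 := mt (key ⟨n, by omega⟩).2 (mt (key' ⟨n, by omega⟩).1 (by simp))
  simp only at k1 k2
  rw [Prod.mk.injEq]
  exact ⟨rfl, by omega⟩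

/-- The vector `flattenedVec μ ε` is `μ` clipped to the interval `[a₁, a₂]`. -/
lemma exists_flattenedVec_eq {d : ℕ} {μ : Fin d → ℝ} (hμ : Antitone μ) (h0 : ∀ i, 0 ≤ μ i)
    (hs : ∑ i, μ i = 1) {ε : ℝ} (hε : 0 < ε) (hlt : ε < deficit μ (d : ℝ)⁻¹) :
    ∃ a₁ a₂ : ℝ, a₁ ≤ (d : ℝ)⁻¹ ∧ (d : ℝ)⁻¹ ≤ a₂ ∧ deficit μ a₁ = ε ∧ excess μ a₂ = ε ∧
      ∀ i, flattenedVec μ ε i = max a₁ (min (μ i) a₂) := by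
  have hL : IsLowLevel μ ε (lowLevel μ ε) :=
    Classical.epsilon_spec (existsUnique_isLowLevel hμ h0 hs hε hlt).exists
  have hH : IsHighLevel μ ε (highLevel μ ε) :=
    Classical.epsilon_spec (existsUnique_isHighLevel hμ h0 hs hε hlt).exists
  unfold flattenedVec
  generalize lowLevel μ ε = a at hL ⊢
  generalize highLevel μ ε = b at hH ⊢
  obtain ⟨a₁, n⟩ := a
  obtain ⟨a₂, m⟩ := b
  obtain ⟨-, -, -, -, h1, k1⟩ := (isLowLevel_iff hμ).1 hL
  obtain ⟨-, -, -, -, h2, k2⟩ := (isHighLevel_iff hμ).1 hH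
  have l1 : a₁ ≤ (d : ℝ)⁻¹ := by
    by_contra! hc
    have := deficit_mono μ hc.le
    linarith
  have l2 : (d : ℝ)⁻¹ ≤ a₂ := by
    by_contra! hc
    have := excess_anti μ hc.le
    rw [excess_inv_card hs] at this
    linarith
  refine ⟨a₁, a₂, l1, l2, h1, h2, fun i => ?_⟩
  simp only [← k1 i, ← k2 i]
  split_ifs with c1 c2
  · rw [min_eq_right c1.le, max_eq_right (l1.trans l2)]
  · rw [min_eq_left (by linarith), max_eq_left c2.le]
  · rw [min_eq_left (by linarith), max_eq_right (by linarith)]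

/-! ### Clipping to an interval: mass, distance and minimality. -/

section Clip

variable {d : ℕ} {μ p : Fin d → ℝ} {ε a₁ a₂ : ℝ}

lemma antitone_clip (hμ : Antitone μ) (hp : ∀ i, p i = max a₁ (min (μ i) a₂)) : Antitone p := by
  intro i j hij
  rw [hp, hp]
  exact max_le_max le_rfl (min_le_min (hμ hij) le_rfl)

lemma clip_sub (h12 : a₁ ≤ a₂) (hp : ∀ i, p i = max a₁ (min (μ i) a₂)) (i : Fin d) :
    p i - μ i = max (a₁ - μ i) 0 - max (μ i - a₂) 0 := by
  rw [hp]
  rcases le_total (μ i) a₂ with h | h <;> rcases le_total (μ i) a₁ with h' | h' <;>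
    simp [h, h', h12]; linarith

lemma abs_clip_sub (h12 : a₁ ≤ a₂) (hp : ∀ i, p i = max a₁ (min (μ i) a₂)) (i : Fin d) :
    |p i - μ i| = max (a₁ - μ i) 0 + max (μ i - a₂) 0 := by
  rw [clip_sub h12 hp]
  rcases le_total (μ i) a₂ with h | h
  · rw [max_eq_right (a := μ i - a₂) (by linarith), sub_zero, add_zero,
      abs_of_nonneg (le_max_right _ _)]
  · rw [max_eq_right (a := a₁ - μ i) (by linarith), zero_sub, zero_add, abs_neg,
      abs_of_nonneg (le_max_right _ _)]

lemma sum_clip (h12 : a₁ ≤ a₂) (hp : ∀ i, p i = max a₁ (min (μ i) a₂))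
    (h1 : deficit μ a₁ = ε) (h2 : excess μ a₂ = ε) : ∑ i, p i = ∑ i, μ i := by
  rw [← sub_eq_zero, ← sum_sub_distrib, sum_congr rfl fun i _ => clip_sub h12 hp i,
    sum_sub_distrib]
  exact sub_eq_zero.2 (h1.trans h2.symm)

lemma sum_abs_clip_sub (h12 : a₁ ≤ a₂) (hp : ∀ i, p i = max a₁ (min (μ i) a₂))
    (h1 : deficit μ a₁ = ε) (h2 : excess μ a₂ = ε) : ∑ i, |p i - μ i| = 2 * ε := by
  rw [sum_congr rfl fun i _ => abs_clip_sub h12 hp i, sum_add_distrib, two_mul]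
  exact congr_arg₂ _ h1 h2

/-- For `t` inside the clipping interval, `p i` lies between `t` and `μ i`. Summed with `t = 1/d`,
this is the equality in the triangle inequality. -/
lemma abs_sub_eq_add_clip {t : ℝ} (h1 : a₁ ≤ t) (h2 : t ≤ a₂)
    (hp : ∀ i, p i = max a₁ (min (μ i) a₂)) (i : Fin d) :
    |μ i - t| = |t - p i| + |p i - μ i| := by
  rcases le_total (μ i) t with h | h
  · have e1 : p i ≤ t := by
      rw [hp]; exact max_le h1 ((min_le_left _ _).trans h)
    have e2 : μ i ≤ p i := by
      rw [hp, min_eq_left (h.trans h2)]; exact le_max_right _ _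
    rw [abs_of_nonpos (by linarith), abs_of_nonneg (by linarith), abs_of_nonneg (by linarith)]
    ring
  · have e1 : t ≤ p i := by
      rw [hp]; exact le_max_of_le_right (le_min h h2)
    have e2 : p i ≤ μ i := by
      rw [hp]; exact max_le (h1.trans h) (min_le_left _ _)
    rw [abs_of_nonneg (by linarith), abs_of_nonpos (by linarith), abs_of_nonpos (by linarith)]
    ring

/-- If the prefix sums of a non-increasing vector `ω` deviate from those of `μ` by at most `ε`, then
`ω` majorizes the vector `μ` clipped at the levels that belong to `ε`. -/
lemma sum_prefix_clip_le (hμ : Antitone μ) (h12 : a₁ ≤ a₂)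
    (hp : ∀ i, p i = max a₁ (min (μ i) a₂)) (h1 : deficit μ a₁ = ε) (h2 : excess μ a₂ = ε)
    {ω : Fin d → ℝ} (hω : Antitone ω) (hs : ∑ i, ω i = ∑ i, μ i)
    (hclose : ∀ k : ℕ, ∑ i with ((i : Fin d) : ℕ) < k, μ i - ε ≤
      ∑ i with ((i : Fin d) : ℕ) < k, ω i) (k : ℕ) :
    ∑ i with ((i : Fin d) : ℕ) < k, p i ≤ ∑ i with ((i : Fin d) : ℕ) < k, ω i := by
  have hm : ∀ j : Fin d, (j : ℕ) < #{i | a₂ < μ i} ↔ a₂ < μ j :=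
    fun j => Tuple.lt_card_gt_iff_apply_gt_of_antitone (j := j) (a := a₂) hμ
  have hr : ∀ j : Fin d, (j : ℕ) < #{i | a₁ ≤ μ i} ↔ a₁ ≤ μ j :=
    fun j => Tuple.lt_card_ge_iff_apply_ge_of_antitone (j := j) (a := a₁) hμ
  have hmr : #{i | a₂ < μ i} ≤ #{i | a₁ ≤ μ i} :=
    card_le_card (monotone_filter_right _ fun i _ h => h12.trans (le_of_lt h))
  have hrd : #{i | a₁ ≤ μ i} ≤ d := (card_le_univ _).trans_eq (Fintype.card_fin d)
  generalize #{i | a₂ < μ i} = m at *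
  generalize #{i | a₁ ≤ μ i} = r at *
  -- For such `k` the prefix contains every entry lowered by the clipping and none that was raised,
  -- so exactly `ε` has been removed from it.
  have mid : ∀ k, m ≤ k → k ≤ r → 0 ≤ ∑ i with ((i : Fin d) : ℕ) < k, (ω i - p i) := by
    intro k hmk hkr
    have e : ∑ i with ((i : Fin d) : ℕ) < k, (μ i - p i) = ε := by
      rw [← h2, sum_filter]
      refine sum_congr rfl fun i _ => ?_
      split_ifs with hi
      · have := (hr i).1 (by omega)
        have := clip_sub h12 hp i
        rw [max_eq_right (a := a₁ - μ i) (by linarith)] at this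
        linarith
      · have := mt (hm i).2 (by omega)
        rw [max_eq_right (by linarith)]
    rw [sum_sub_distrib] at e ⊢
    linarith [hclose k]
  have total : ∀ k, d ≤ k → 0 ≤ ∑ i with ((i : Fin d) : ℕ) < k, (ω i - p i) := by
    intro k hk
    rw [sum_prefix_eq_sum _ hk, sum_sub_distrib, hs, sum_clip h12 hp h1 h2, sub_self]
  have main : 0 ≤ ∑ i with ((i : Fin d) : ℕ) < k, (ω i - p i) := by
    rcases le_total k m with hk | hk
    · refine sum_prefix_sub_nonneg_of_block hω (Nat.zero_le k) hk (a := a₂) (fun i _ hi => ?_)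
        (by simp) (mid m le_rfl hmr)
      rw [hp, min_eq_right ((hm i).1 hi).le, max_eq_right h12]
    · rcases le_total k r with hk' | hk'
      · exact mid k hk hk'
      · rcases le_total k d with hk'' | hk''
        · refine sum_prefix_sub_nonneg_of_block hω hk' hk'' (a := a₁) (fun i hi _ => ?_)
            (mid r hmr le_rfl) (total d le_rfl)
          have := mt (hr i).2 (by omega)
          rw [hp, min_eq_left (by linarith), max_eq_left (by linarith)]
        · exact total k hk''
  rw [sum_sub_distrib] at main
  linarith

end Clip

/-- Clipping for `ε₂` and then for `ε₁` is clipping for `ε₁ + ε₂`. -/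
lemma flattenedVec_add {d : ℕ} {μ : Fin d → ℝ} (hμ : Antitone μ) (h0 : ∀ i, 0 ≤ μ i)
    (hs : ∑ i, μ i = 1) {ε₁ ε₂ : ℝ} (hε₁ : 0 < ε₁) (hε₂ : 0 < ε₂)
    (hlt : ε₁ + ε₂ < deficit μ (d : ℝ)⁻¹)
    (h0' : ∀ i, 0 ≤ flattenedVec μ ε₂ i) (hs' : ∑ i, flattenedVec μ ε₂ i = 1)
    (hlt' : ε₁ < deficit (flattenedVec μ ε₂) (d : ℝ)⁻¹) :
    flattenedVec μ (ε₁ + ε₂) = flattenedVec (flattenedVec μ ε₂) ε₁ := by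
  obtain ⟨a₁, a₂, ha₁, ha₂, hd, he, hp⟩ :=
    exists_flattenedVec_eq hμ h0 hs hε₂ (by linarith)
  obtain ⟨c₁, c₂, -, -, hd', he', hp'⟩ :=
    exists_flattenedVec_eq hμ h0 hs (by linarith : 0 < ε₁ + ε₂) hlt
  have hν := antitone_clip hμ hp
  generalize flattenedVec μ ε₂ = ν at *
  obtain ⟨b₁, b₂, hb₁, hb₂, hd'', he'', hp''⟩ := exists_flattenedVec_eq hν h0' hs' hε₁ hlt'
  -- A positive deficit at `b₁` needs an entry of `ν` below `b₁`, while no entry of `ν` is below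
  -- `a₁`. So the second clipping interval is nested in the first.
  have hab₁ : a₁ ≤ b₁ := by
    obtain ⟨i, hi⟩ := exists_lt_of_deficit_pos (hd'' ▸ hε₁)
    rw [hp] at hi
    exact (le_max_left _ _).trans hi.le
  have hab₂ : b₂ ≤ a₂ := by
    obtain ⟨i, hi⟩ := exists_gt_of_excess_pos (he'' ▸ hε₁)
    rw [hp] at hi
    exact hi.le.trans (max_le (ha₁.trans ha₂) (min_le_right _ _))
  -- Entrywise, the shortfall of `μ` below `b₁` is its shortfall below `a₁` plus that of `ν` below
  -- `b₁`; the upper clipping is not seen since `b₁ ≤ 1/d ≤ a₂`. Hence the deficit of `μ` at `b₁` is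
  -- `ε₁ + ε₂`, which determines the level.
  have e₁ : c₁ = b₁ := by
    refine eq_of_deficit_eq (x := μ) (by rw [hd']; linarith) ?_
    rw [hd', ← hd, ← hd'']
    unfold deficit
    rw [← sum_add_distrib]
    refine sum_congr rfl fun i _ => ?_
    rw [hp]
    rcases le_total (μ i) a₂ with h | h <;> rcases le_total (μ i) a₁ with h' | h' <;>
      rcases le_total (μ i) b₁ with h'' | h'' <;>
      simp [h, h', h''] <;> grind
  have e₂ : c₂ = b₂ := by
    refine eq_of_excess_eq (x := μ) (by rw [he']; linarith) ?_
    rw [he', ← he, ← he'']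
    unfold excess
    rw [← sum_add_distrib]
    refine sum_congr rfl fun i _ => ?_
    rw [hp]
    rcases le_total (μ i) a₂ with h | h <;> rcases le_total (μ i) a₁ with h' | h' <;>
      rcases le_total (μ i) b₂ with h'' | h'' <;>
      simp [h, h', h''] <;> grind
  ext i
  rw [hp', hp'', hp, e₁, e₂]
  grind

/-! The vector `spreadVec`. -/

lemma sum_ite_val_eq {d j : ℕ} (hj : j < d) (c : ℝ) :
    ∑ i : Fin d, (if (i : ℕ) = j then c else 0) = c := by
  rw [sum_eq_single ⟨j, hj⟩]
  · simp
  · intro i _ hi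
    rw [if_neg fun h => hi (Fin.ext h)]
  · simp

/-- Replaces the tail length `ℓ` by the zero-based index `j = d - 1 - ℓ` of the entry that is only
partly emptied. Maximality of `ℓ` says that emptying `j` as well would exceed `ε`. -/
lemma spreadVec_cases {d : ℕ} (hd : 0 < d) (μ : Fin d → ℝ) {ε : ℝ} (hε : 0 ≤ ε) :
    ((∀ i, spreadVec μ ε i = if (i : ℕ) = 0 then 1 else 0) ∧
      ∑ i with ((i : Fin d) : ℕ) ≠ 0, μ i ≤ ε) ∨
    ∃ j : Fin d, 0 < (j : ℕ) ∧ ∑ i with j < i, μ i ≤ ε ∧ ε < ∑ i with j < i, μ i + μ j ∧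
      ∀ i, spreadVec μ ε i = if (i : ℕ) = 0 then μ i + ε else if i < j then μ i else
        if i = j then μ i - (ε - ∑ i with j < i, μ i) else 0 := by
  classical
  have hspec : tailSum μ (tailLength μ ε) ≤ ε := by
    refine Nat.findGreatest_spec (P := fun l => tailSum μ l ≤ ε) (Nat.zero_le _) ?_
    have : tailSum μ 0 = 0 := by
      unfold tailSum
      rw [filter_false_of_mem, sum_empty]
      intro i _
      have := i.2
      omega
    simpa [this] using hε
  have hle : tailLength μ ε ≤ d - 1 := Nat.findGreatest_le _
  have hmax : ∀ k, tailLength μ ε < k → k ≤ d - 1 → ε < tailSum μ k := fun k h1 h2 =>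
    not_le.1 (Nat.findGreatest_is_greatest (P := fun l => tailSum μ l ≤ ε) h1 h2)
  unfold spreadVec
  generalize tailLength μ ε = l at *
  by_cases h : l = d - 1
  · left
    simp only [h, if_true, implies_true, true_and]
    subst h
    refine le_of_eq_of_le (sum_congr (filter_congr fun i _ => ?_) fun _ _ => rfl) hspec
    omega
  · right
    simp only [h, if_false]
    have htail : tailSum μ l = ∑ i with (⟨d - 1 - l, by omega⟩ : Fin d) < i, μ i := by
      refine sum_congr (filter_congr fun i _ => ?_) fun _ _ => rfl
      rw [Fin.lt_def]
      simp only
      omega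
    have htail' : tailSum μ (l + 1) =
        ∑ i with (⟨d - 1 - l, by omega⟩ : Fin d) < i, μ i + μ ⟨d - 1 - l, by omega⟩ := by
      have : (univ.filter fun i : Fin d => d ≤ (i : ℕ) + (l + 1)) =
          insert ⟨d - 1 - l, by omega⟩
            (univ.filter fun i : Fin d => (⟨d - 1 - l, by omega⟩ : Fin d) < i) := by
        ext i
        simp only [mem_filter, mem_univ, true_and, mem_insert, Fin.ext_iff, Fin.lt_def]
        omega
      unfold tailSum
      rw [this, sum_insert (by simp), add_comm]
    refine ⟨⟨d - 1 - l, by omega⟩, by simp only; omega, htail ▸ hspec,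
      htail' ▸ hmax (l + 1) (by omega) (by omega), fun i => ?_⟩
    rw [htail]
    have := i.2
    simp only [Fin.lt_def, Fin.ext_iff]
    congr 1
    congr 1
    · rw [eq_iff_iff]; omega
    · congr 1
      rw [eq_iff_iff]; omega

section Spread

variable {d : ℕ} {μ p : Fin d → ℝ} {ε : ℝ}

/-- The vector moves mass from the tail to the first entry: `ε` in the partial case, and the whole
tail, of mass at most `ε`, in the pure case. In the partial case a prefix that stops at or before
`j` has gained `ε`, and a longer one already contains all the mass. -/
lemma spreadVec_facts (hμ : Antitone μ) (h0 : ∀ i, 0 ≤ μ i) (hs : ∑ i, μ i = 1) (hε : 0 < ε) :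
    Antitone (spreadVec μ ε) ∧ (∀ i, 0 ≤ spreadVec μ ε i) ∧ ∑ i, spreadVec μ ε i = 1 ∧
      ((∑ i, |spreadVec μ ε i - μ i| ≤ 2 * ε ∧
          ∀ i, spreadVec μ ε i = if (i : ℕ) = 0 then 1 else 0) ∨
        ∑ i, |spreadVec μ ε i - μ i| = 2 * ε) ∧
      ∀ k : ℕ, 1 ≤ k → ∑ i with ((i : Fin d) : ℕ) < k, spreadVec μ ε i = 1 ∨
        ∑ i with ((i : Fin d) : ℕ) < k, spreadVec μ ε i =
          ∑ i with ((i : Fin d) : ℕ) < k, μ i + ε := by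
  have hd := pos_of_sum_eq_one hs
  rcases spreadVec_cases hd μ hε.le with ⟨hp, hQ⟩ | ⟨j, hj, hQ1, hQ2, hp⟩
  · generalize spreadVec μ ε = p at *
    have hsum : ∑ i, p i = 1 := by
      rw [sum_congr rfl fun i _ => hp i, sum_ite_val_eq hd]
    refine ⟨fun i j hij => ?_, fun i => ?_, hsum, Or.inl ⟨?_, hp⟩, fun k hk => Or.inl ?_⟩
    · rw [hp, hp]
      have := Fin.le_def.1 hij
      split_ifs <;> first | omega | norm_num
    · rw [hp]; split_ifs <;> norm_num
    · have e : ∀ i, |p i - μ i| = p i - μ i + 2 * (if (i : ℕ) ≠ 0 then μ i else 0) := by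
        intro i
        have h1 : μ i ≤ 1 := hs ▸ single_le_sum (fun i _ => h0 i) (mem_univ i)
        rw [hp]
        by_cases hi : (i : ℕ) = 0
        · simp only [hi, if_true, ne_eq, not_true, if_false]
          rw [abs_of_nonneg (by linarith)]
          ring
        · simp only [hi, if_false, ne_eq, not_false_eq_true, if_true]
          rw [abs_of_nonpos (by linarith [h0 i])]
          ring
      rw [sum_congr rfl fun i _ => e i, sum_add_distrib, sum_sub_distrib, ← mul_sum, ← sum_filter,
        hs, hsum]
      linarith
    · rw [← hsum, sum_filter]
      refine sum_congr rfl fun i _ => ?_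
      rw [hp]
      split_ifs <;> first | omega | rfl
  · set Q := ∑ i with j < i, μ i with hQ
    generalize spreadVec μ ε = p at *
    have diff : ∀ i, p i - μ i = (if (i : ℕ) = 0 then ε else 0) -
        (if (i : ℕ) = (j : ℕ) then ε - Q else 0) - (if j < i then μ i else 0) := by
      intro i
      rw [hp]
      simp only [Fin.lt_def, Fin.ext_iff]
      split_ifs <;> first | omega | ring
    -- The three changes in `diff` have disjoint supports because `0 < j`, so absolute values may be
    -- taken term by term.
    have absdiff : ∀ i, |p i - μ i| = (if (i : ℕ) = 0 then ε else 0) +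
        (if (i : ℕ) = (j : ℕ) then ε - Q else 0) + (if j < i then μ i else 0) := by
      intro i
      rw [diff]
      have := h0 i
      simp only [Fin.lt_def]
      split_ifs <;> first
        | omega
        | (simp only [sub_zero, zero_sub, add_zero, zero_add, abs_neg]
           exact abs_of_nonneg (by linarith))
    have hsum : ∑ i, p i = 1 := by
      rw [← hs, ← sub_eq_zero, ← sum_sub_distrib, sum_congr rfl fun i _ => diff i,
        sum_sub_distrib, sum_sub_distrib, sum_ite_val_eq hd, sum_ite_val_eq j.2, ← sum_filter, ← hQ]
      ring
    refine ⟨fun a b hab => ?_, fun i => ?_, hsum, Or.inr ?_, fun k hk => ?_⟩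
    · have h1 := hμ hab
      have h2 := h0 a
      rw [hp, hp]
      have hab := Fin.le_def.1 hab
      simp only [Fin.lt_def, Fin.ext_iff]
      split_ifs with c1 c2 c3 c4 c5 c6 c7 c8 c9 c10 <;> first
        | omega
        | linarith
        | (obtain rfl : a = j := Fin.ext (by assumption)
           linarith)
    · have h2 := h0 i
      rw [hp]
      split_ifs with c1 c2 c3
      · linarith
      · linarith
      · subst c3; linarith
      · exact le_rfl
    · rw [sum_congr rfl fun i _ => absdiff i, sum_add_distrib, sum_add_distrib, sum_ite_val_eq hd,
        sum_ite_val_eq j.2, ← sum_filter, ← hQ]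
      ring
    · rcases le_or_gt k (j : ℕ) with hkj | hkj
      · right
        rw [← sub_eq_iff_eq_add', ← sum_sub_distrib, sum_filter]
        refine (sum_congr rfl fun i _ => ?_).trans (sum_ite_val_eq hd ε)
        rw [diff]
        simp only [Fin.lt_def]
        split_ifs <;> first | omega | ring
      · left
        rw [← hsum, sum_filter]
        refine sum_congr rfl fun i _ => ?_
        rw [hp]
        simp only [Fin.lt_def, Fin.ext_iff]
        split_ifs <;> first | omega | rfl

/-- A nonnegative vector of total mass one whose prefix sums exceed those of `μ` by at most `ε` is
majorized by `spreadVec μ ε`. -/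
lemma sum_prefix_le_spreadVec (hμ : Antitone μ) (h0 : ∀ i, 0 ≤ μ i) (hs : ∑ i, μ i = 1)
    (hε : 0 < ε) {ω : Fin d → ℝ} (hω0 : ∀ i, 0 ≤ ω i) (hωs : ∑ i, ω i = 1)
    (hclose : ∀ k : ℕ, ∑ i with ((i : Fin d) : ℕ) < k, ω i ≤
      ∑ i with ((i : Fin d) : ℕ) < k, μ i + ε) (k : ℕ) :
    ∑ i with ((i : Fin d) : ℕ) < k, ω i ≤ ∑ i with ((i : Fin d) : ℕ) < k, spreadVec μ ε i := by
  rcases Nat.eq_zero_or_pos k with rfl | hk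
  · simp
  rcases (spreadVec_facts hμ h0 hs hε).2.2.2.2 k hk with h | h
  · rw [h, ← hωs]
    exact sum_le_sum_of_subset_of_nonneg (filter_subset _ _) fun i _ _ => hω0 i
  · rw [h]
    exact hclose k

end Spread

/-! The vector of the majorization-minimal state. -/

/-- The vector of eigenvalues of the majorization-minimal state. -/
def minVec {d : ℕ} (μ : Fin d → ℝ) (ε : ℝ) : Fin d → ℝ :=
  if ε < deficit μ (d : ℝ)⁻¹ then flattenedVec μ ε else fun _ => (d : ℝ)⁻¹

section MinVec

variable {d : ℕ} {μ : Fin d → ℝ} {ε : ℝ}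

lemma sum_abs_sub_inv_card (hs : ∑ i, μ i = 1) :
    ∑ i, |μ i - (d : ℝ)⁻¹| = 2 * deficit μ (d : ℝ)⁻¹ := by
  rw [sum_abs_sub_const, excess_inv_card hs, two_mul]

/-- All that the operator level needs, for both cases of the definition at once. That the entries
are a function of those of `μ` is what makes the operator independent of the eigenbasis. -/
lemma minVec_facts (hμ : Antitone μ) (h0 : ∀ i, 0 ≤ μ i) (hs : ∑ i, μ i = 1) (hε : 0 < ε) :
    Antitone (minVec μ ε) ∧ (∀ i, 0 ≤ minVec μ ε i) ∧ ∑ i, minVec μ ε i = 1 ∧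
      ∑ i, |minVec μ ε i - μ i| ≤ 2 * ε ∧
      ((minVec μ ε = fun _ => (d : ℝ)⁻¹) ∨ ∑ i, |minVec μ ε i - μ i| = 2 * ε) ∧
      ∑ i, |μ i - (d : ℝ)⁻¹| = ∑ i, |(d : ℝ)⁻¹ - minVec μ ε i| + ∑ i, |minVec μ ε i - μ i| ∧
      (∃ f : ℝ → ℝ, ∀ i, minVec μ ε i = f (μ i)) ∧
      ∀ ω : Fin d → ℝ, Antitone ω → ∑ i, ω i = 1 →
        (∀ k : ℕ, ∑ i with ((i : Fin d) : ℕ) < k, μ i - ε ≤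
          ∑ i with ((i : Fin d) : ℕ) < k, ω i) →
        ∀ k : ℕ, ∑ i with ((i : Fin d) : ℕ) < k, minVec μ ε i ≤
          ∑ i with ((i : Fin d) : ℕ) < k, ω i := by
  have hd := pos_of_sum_eq_one hs
  unfold minVec
  split_ifs with h
  · obtain ⟨a₁, a₂, h1, h2, hd1, he, hp⟩ := exists_flattenedVec_eq hμ h0 hs hε h
    have h12 := h1.trans h2
    generalize flattenedVec μ ε = p at *
    refine ⟨antitone_clip hμ hp, fun i => ?_, (sum_clip h12 hp hd1 he).trans hs,
      (sum_abs_clip_sub h12 hp hd1 he).le, Or.inr (sum_abs_clip_sub h12 hp hd1 he), ?_,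
      ⟨fun x => max a₁ (min x a₂), hp⟩, fun ω hω hωs hclose =>
        sum_prefix_clip_le hμ h12 hp hd1 he hω (hωs.trans hs.symm) hclose⟩
    · rw [hp]
      exact le_max_of_le_right (le_min (h0 i) (le_trans (by positivity) h2))
    · rw [← sum_add_distrib]
      exact sum_congr rfl fun i _ => abs_sub_eq_add_clip h1 h2 hp i
  · have hsw : ∑ i, |(d : ℝ)⁻¹ - μ i| = 2 * deficit μ (d : ℝ)⁻¹ := by
      rw [← sum_abs_sub_inv_card hs]
      exact sum_congr rfl fun i _ => abs_sub_comm _ _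
    refine ⟨antitone_const, fun i => by positivity, sum_inv_card hd, ?_, Or.inl rfl, ?_,
      ⟨fun _ => (d : ℝ)⁻¹, fun _ => rfl⟩, fun ω hω hωs _ =>
        sum_prefix_const_le hω (hωs.trans (sum_inv_card hd).symm)⟩
    · rw [hsw]; linarith
    · rw [hsw, sum_abs_sub_inv_card hs]; simp

lemma minVec_add (hμ : Antitone μ) (h0 : ∀ i, 0 ≤ μ i) (hs : ∑ i, μ i = 1) {ε₁ ε₂ : ℝ}
    (hε₁ : 0 < ε₁) (hε₂ : 0 < ε₂) : minVec μ (ε₁ + ε₂) = minVec (minVec μ ε₂) ε₁ := by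
  obtain ⟨-, g0, gs, -, g1, g2, -, -⟩ := minVec_facts hμ h0 hs hε₂
  -- By the triangle equality, flattening by `ε₂` uses up exactly `ε₂` of the distance to the
  -- constant vector, unless that vector has been reached.
  have hdef : (minVec μ ε₂ = fun _ => (d : ℝ)⁻¹) ∨
      deficit μ (d : ℝ)⁻¹ = deficit (minVec μ ε₂) (d : ℝ)⁻¹ + ε₂ := by
    refine g1.imp_right fun g1 => ?_
    have := sum_abs_sub_inv_card gs
    simp_rw [abs_sub_comm _ (d : ℝ)⁻¹] at this
    rw [sum_abs_sub_inv_card hs, g1, this] at g2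
    linarith
  by_cases h : ε₂ < deficit μ (d : ℝ)⁻¹
  · have e : minVec μ ε₂ = flattenedVec μ ε₂ := if_pos h
    rcases hdef with hdef | hdef
    · have : deficit (minVec μ ε₂) (d : ℝ)⁻¹ = 0 := by simp [hdef, deficit]
      -- A contradiction: reaching the constant vector by a proper clipping would put it at distance
      -- exactly `ε₂`, against `h`.
      have hgs : ∑ i, |μ i - (d : ℝ)⁻¹| = 2 * ε₂ := by
        obtain ⟨a₁, a₂, h1, h2, hd1, he, hp⟩ := exists_flattenedVec_eq hμ h0 hs hε₂ h
        rw [← e] at hp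
        rw [← sum_abs_clip_sub (h1.trans h2) hp hd1 he, hdef]
        exact sum_congr rfl fun i _ => abs_sub_comm _ _
      rw [sum_abs_sub_inv_card hs] at hgs
      linarith
    · by_cases h' : ε₁ + ε₂ < deficit μ (d : ℝ)⁻¹
      · have h'' : ε₁ < deficit (minVec μ ε₂) (d : ℝ)⁻¹ := by linarith
        rw [minVec, if_pos h', minVec, if_pos h'']
        rw [e] at g0 gs h'' ⊢
        exact flattenedVec_add hμ h0 hs hε₁ hε₂ h' g0 gs h''
      · rw [minVec, if_neg h', minVec, if_neg (by linarith)]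
  · have e : minVec μ ε₂ = fun _ => (d : ℝ)⁻¹ := if_neg h
    have hz : deficit (fun _ : Fin d => (d : ℝ)⁻¹) (d : ℝ)⁻¹ = 0 := by simp [deficit]
    rw [e, minVec, if_neg (by linarith), minVec, if_neg (by rw [hz]; linarith)]

end MinVec

/-! Diagonal operators. -/

section Operators

variable {H : Type*} [NormedAddCommGroup H] [InnerProductSpace ℂ H] [FiniteDimensional ℂ H]

local notation "ι" => Fin (Module.finrank ℂ H)

lemma diagOp_apply (b : OrthonormalBasis ι ℂ H) (p : ι → ℝ) (x : H) :
    diagOp b p x = ∑ i, ((p i : ℝ) : ℂ) • inner ℂ (b i) x • b i := by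
  simp [diagOp]

lemma diagOp_apply_self (b : OrthonormalBasis ι ℂ H) (p : ι → ℝ) (j : ι) :
    diagOp b p (b j) = ((p j : ℝ) : ℂ) • b j := by
  rw [diagOp_apply, sum_eq_single j]
  · simp
  · intro i _ hij
    rw [b.inner_eq_ite, if_neg hij, zero_smul, smul_zero]
  · simp

lemma OrthonormalBasis.ext_continuousLinearMap (b : OrthonormalBasis ι ℂ H) {A B : H →L[ℂ] H}
    (h : ∀ i, A (b i) = B (b i)) : A = B :=
  ContinuousLinearMap.coe_injective (b.toBasis.ext fun i => by simpa using h i)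

lemma eq_diagOp (b : OrthonormalBasis ι ℂ H) {p : ι → ℝ} {A : H →L[ℂ] H}
    (h : ∀ i, A (b i) = ((p i : ℝ) : ℂ) • b i) : A = diagOp b p :=
  b.ext_continuousLinearMap fun i => (h i).trans (diagOp_apply_self b p i).symm

lemma diagOp_sub (b : OrthonormalBasis ι ℂ H) (p q : ι → ℝ) :
    diagOp b p - diagOp b q = diagOp b (fun i => p i - q i) :=
  eq_diagOp b fun i => by
    rw [sub_apply, diagOp_apply_self, diagOp_apply_self, ← sub_smul]
    push_cast
    rfl

lemma inner_diagOp (b : OrthonormalBasis ι ℂ H) (p : ι → ℝ) (x : H) :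
    inner ℂ x (diagOp b p x) = ((∑ i, p i * ‖inner ℂ (b i) x‖ ^ 2 : ℝ) : ℂ) := by
  rw [diagOp_apply, inner_sum]
  push_cast
  refine sum_congr rfl fun i _ => ?_
  rw [inner_smul_right, inner_smul_right, ← inner_conj_symm x (b i), Complex.mul_conj,
    Complex.normSq_eq_norm_sq]
  push_cast
  rfl

lemma diagOp_isSymmetric (b : OrthonormalBasis ι ℂ H) (p : ι → ℝ) :
    (diagOp b p : H →ₗ[ℂ] H).IsSymmetric := by
  intro x y
  simp only [ContinuousLinearMap.coe_coe]
  rw [diagOp_apply, diagOp_apply, sum_inner, inner_sum]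
  refine sum_congr rfl fun i _ => ?_
  rw [inner_smul_left, inner_smul_left, inner_smul_right, inner_smul_right, inner_conj_symm,
    Complex.conj_ofReal]
  ring

lemma diagOp_isPositive (b : OrthonormalBasis ι ℂ H) {p : ι → ℝ} (hp : ∀ i, 0 ≤ p i) :
    (diagOp b p).IsPositive := by
  refine ⟨diagOp_isSymmetric b p, fun x => ?_⟩
  rw [ContinuousLinearMap.reApplyInnerSelf_apply, inner_re_symm, inner_diagOp, RCLike.re_eq_complex_re,
    Complex.ofReal_re]
  exact sum_nonneg fun i _ => mul_nonneg (hp i) (sq_nonneg _)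

lemma trace_diagOp (b : OrthonormalBasis ι ℂ H) (p : ι → ℝ) :
    LinearMap.trace ℂ H (diagOp b p : H →ₗ[ℂ] H) = ((∑ i, p i : ℝ) : ℂ) := by
  rw [LinearMap.trace_eq_sum_inner _ b]
  push_cast
  refine sum_congr rfl fun i _ => ?_
  rw [diagOp_apply_self, inner_smul_right, b.inner_eq_one, mul_one]

lemma isQState_diagOp (b : OrthonormalBasis ι ℂ H) {p : ι → ℝ} (hp : ∀ i, 0 ≤ p i)
    (hs : ∑ i, p i = 1) : IsQState (diagOp b p) :=
  ⟨diagOp_isPositive b hp, by rw [trace_diagOp, hs, Complex.ofReal_one]⟩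

lemma mixedState_eq_diagOp (b : OrthonormalBasis ι ℂ H) :
    mixedState H = diagOp b fun _ => (Module.finrank ℂ H : ℝ)⁻¹ :=
  eq_diagOp b fun i => by simp [mixedState]

/-! ### Ordered eigenvalues and Ky Fan's principle. -/

lemma eigVec_antitone (A : H →L[ℂ] H) : Antitone (eigVec A) := by
  unfold eigVec
  split_ifs with h
  · exact h.eigenvalues_antitone rfl
  · exact antitone_const

lemma chosenEigenbasis_isSorted {A : H →L[ℂ] H} (hA : (A : H →ₗ[ℂ] H).IsSymmetric) :
    IsSortedEigenbasis A (chosenEigenbasis A) := by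
  intro i
  unfold eigVec chosenEigenbasis
  rw [dif_pos hA, dif_pos hA]
  exact hA.apply_eigenvectorBasis rfl i

lemma IsSortedEigenbasis.eq_diagOp {A : H →L[ℂ] H} {b : OrthonormalBasis ι ℂ H}
    (hb : IsSortedEigenbasis A b) : A = diagOp b (eigVec A) :=
  _root_.eq_diagOp b hb

/-- Ky Fan's maximum principle. -/
lemma sum_prefix_inner_diagOp_le (b c : OrthonormalBasis ι ℂ H) {p : ι → ℝ} (hp : Antitone p)
    (k : ℕ) :
    ∑ i with ((i : ι) : ℕ) < k, (inner ℂ (c i) (diagOp b p (c i))).re ≤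
      ∑ i with ((i : ι) : ℕ) < k, p i := by
  wlog hk : k ≤ Module.finrank ℂ H generalizing k
  · have := this _ le_rfl
    rwa [sum_prefix_eq_sum _ le_rfl, sum_prefix_eq_sum _ le_rfl,
      ← sum_prefix_eq_sum _ (le_of_not_ge hk), ← sum_prefix_eq_sum p (le_of_not_ge hk)] at this
  -- The weight of `p j` is the squared length of the projection of `b j` onto the span of the first
  -- `k` vectors of `c`: at most `1` each, and `k` in total.
  have e : ∑ i with ((i : ι) : ℕ) < k, (inner ℂ (c i) (diagOp b p (c i))).re =
      ∑ j, p j * ∑ i with ((i : ι) : ℕ) < k, ‖inner ℂ (b j) (c i)‖ ^ 2 := by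
    simp_rw [inner_diagOp, Complex.ofReal_re, mul_sum]
    exact sum_comm
  rw [e]
  refine sum_mul_le_sum_prefix hp (fun j => sum_nonneg fun i _ => sq_nonneg _) (fun j => ?_) hk ?_
  · refine (sum_le_sum_of_subset_of_nonneg (filter_subset _ _) fun i _ _ => sq_nonneg _).trans ?_
    rw [c.sum_sq_norm_inner_left]
    simp
  · rw [sum_comm]
    simp_rw [b.sum_sq_norm_inner_right]
    simp [Fin.card_filter_val_lt, hk]

/-- The library eigenvalues and `p` diagonalise the same operator in two bases. Ky Fan's principle,
used in both directions, makes their prefix sums agree. -/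
lemma eigVec_diagOp (b : OrthonormalBasis ι ℂ H) {p : ι → ℝ} (hp : Antitone p) :
    eigVec (diagOp b p) = p := by
  have hA := chosenEigenbasis_isSorted (diagOp_isSymmetric b p)
  set A := diagOp b p with hAdef
  have hA' := hA.eq_diagOp
  refine eq_of_sum_prefix_eq fun k => le_antisymm ?_ ?_
  · have := sum_prefix_inner_diagOp_le b (chosenEigenbasis A) hp k
    rw [← hAdef] at this
    simp_rw [hA _, inner_smul_right, OrthonormalBasis.inner_eq_one, mul_one, Complex.ofReal_re]
      at this
    exact this
  · have := sum_prefix_inner_diagOp_le (chosenEigenbasis A) b (eigVec_antitone A) k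
    rw [← hA', hAdef] at this
    simp_rw [diagOp_apply_self, inner_smul_right, OrthonormalBasis.inner_eq_one, mul_one,
      Complex.ofReal_re] at this
    exact this

lemma isSortedEigenbasis_diagOp (b : OrthonormalBasis ι ℂ H) {p : ι → ℝ} (hp : Antitone p) :
    IsSortedEigenbasis (diagOp b p) b := fun i => by
  rw [eigVec_diagOp b hp, diagOp_apply_self]

/-- A function of the eigenvalues defines an operator that does not depend on the eigenbasis. -/
lemma diagOp_comp_eq {A : H →L[ℂ] H} {b c : OrthonormalBasis ι ℂ H} (hb : IsSortedEigenbasis A b)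
    (hc : IsSortedEigenbasis A c) {p : ι → ℝ} (hp : ∃ f : ℝ → ℝ, ∀ i, p i = f (eigVec A i)) :
    diagOp b p = diagOp c p := by
  obtain ⟨f, hf⟩ := hp
  refine eq_diagOp c fun j => ?_
  -- Eigenvectors for different eigenvalues are orthogonal, so only indices with the same
  -- eigenvalue, hence the same value of `f`, contribute.
  have key : ∀ i, ((p i : ℝ) : ℂ) • inner ℂ (b i) (c j) • b i =
      ((p j : ℝ) : ℂ) • inner ℂ (b i) (c j) • b i := by
    intro i
    by_cases h : eigVec A i = eigVec A j
    · rw [hf, hf, h]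
    · have hsym := (hb.eq_diagOp ▸ diagOp_isSymmetric b (eigVec A) :
        (A : H →ₗ[ℂ] H).IsSymmetric) (b i) (c j)
      simp only [ContinuousLinearMap.coe_coe] at hsym
      rw [hb i, hc j, inner_smul_left, inner_smul_right, Complex.conj_ofReal,
        ← sub_eq_zero, ← sub_mul, mul_eq_zero] at hsym
      rcases hsym with hsym | hsym
      · exact absurd (by exact_mod_cast sub_eq_zero.1 hsym) h
      · simp [hsym]
  rw [diagOp_apply, sum_congr rfl fun i _ => key i, ← smul_sum, b.sum_repr' (c j)]

lemma IsQState.eigVec_nonneg {A : H →L[ℂ] H} (hA : IsQState A) (i : ι) : 0 ≤ eigVec A i := by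
  have hs : (A : H →ₗ[ℂ] H).IsSymmetric := hA.1.isSymmetric
  unfold eigVec
  rw [dif_pos hs]
  exact hA.1.toLinearMap.nonneg_eigenvalues rfl i

lemma IsQState.sum_eigVec {A : H →L[ℂ] H} (hA : IsQState A) : ∑ i, eigVec A i = 1 := by
  have h := (chosenEigenbasis_isSorted hA.1.isSymmetric).eq_diagOp
  have h2 := hA.2
  rw [h, trace_diagOp] at h2
  exact_mod_cast h2

/-- The sum of squares of the eigenvalues is the squared Hilbert-Schmidt norm. -/
lemma sum_norm_sq_apply (b : OrthonormalBasis ι ℂ H) {A : H →L[ℂ] H}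
    (hA : (A : H →ₗ[ℂ] H).IsSymmetric) : ∑ i, ‖A (b i)‖ ^ 2 = ∑ i, eigVec A i ^ 2 := by
  -- In every basis the sum is the trace of `A²`; it is then evaluated in an eigenbasis.
  have h : ∀ c : OrthonormalBasis ι ℂ H, ((∑ i, ‖A (c i)‖ ^ 2 : ℝ) : ℂ) =
      LinearMap.trace ℂ H ((A : H →ₗ[ℂ] H) ∘ₗ (A : H →ₗ[ℂ] H)) := by
    intro c
    rw [LinearMap.trace_eq_sum_inner _ c]
    push_cast
    refine sum_congr rfl fun i _ => ?_
    exact (inner_self_eq_norm_sq_to_K (A (c i))).symm.trans (hA (c i) (A (c i)))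
  have hc := chosenEigenbasis_isSorted hA
  have := (h b).trans (h (chosenEigenbasis A)).symm
  rw [Complex.ofReal_inj] at this
  rw [this]
  refine sum_congr rfl fun i _ => ?_
  rw [hc i, norm_smul]
  simp

lemma opMajorizedBy_iff (A B : H →L[ℂ] H) :
    opMajorizedBy A B ↔
      (∀ k : ℕ, ∑ i with ((i : ι) : ℕ) < k, eigVec A i ≤
        ∑ i with ((i : ι) : ℕ) < k, eigVec B i) ∧ ∑ i, eigVec A i = ∑ i, eigVec B i :=
  vecMajorizedBy_iff_of_antitone (eigVec_antitone A) (eigVec_antitone B)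

lemma eigVec_eq_of_opMajorizedBy {A B : H →L[ℂ] H} (h1 : opMajorizedBy A B)
    (h2 : opMajorizedBy B A) : eigVec A = eigVec B :=
  eq_of_sum_prefix_eq fun k =>
    le_antisymm (((opMajorizedBy_iff A B).1 h1).1 k) (((opMajorizedBy_iff B A).1 h2).1 k)

end Operators

/-! ### A criterion for the relative boundary. -/

/-- A point of `s` lies on the relative boundary if some segment of `s` ending there cannot be
prolonged within `s`. -/
lemma mem_intrinsicFrontier_of_forall_notMem {E : Type*} [NormedAddCommGroup E] [NormedSpace ℝ E]
    {s : Set E} {x y : E} (hx : x ∈ s) (hy : y ∈ s) (h : ∀ t : ℝ, 0 < t → x + t • (x - y) ∉ s) :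
    x ∈ intrinsicFrontier ℝ s := by
  rw [← intrinsicClosure_sdiff_intrinsicInterior]
  refine ⟨subset_intrinsicClosure hx, fun hint => ?_⟩
  obtain ⟨z, hz, hzx⟩ := mem_intrinsicInterior.1 hint
  -- The line from `y` through `x`, as a continuous path in the affine span with `f 0 = x`; at a
  -- relative interior point it would stay in `s` for small positive times.
  let f : ℝ → affineSpan ℝ s := fun t => ⟨AffineMap.lineMap y x (1 + t),
    AffineMap.lineMap_mem _ (subset_affineSpan ℝ s hy) (subset_affineSpan ℝ s hx)⟩
  have hf : Continuous f := by
    refine Continuous.subtype_mk ?_ _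
    exact AffineMap.lineMap_continuous.comp (continuous_const.add continuous_id)
  have hf0 : f 0 = z := Subtype.ext (by simp [f, hzx])
  have hev : ∀ᶠ t in nhds (0 : ℝ), (f t : E) ∈ s :=
    hf.continuousAt.eventually (hf0 ▸ mem_interior_iff_mem_nhds.1 hz)
  obtain ⟨δ, hδ, hball⟩ := Metric.eventually_nhds_iff.1 hev
  refine h (δ / 2) (by positivity) ?_
  have := @hball (δ / 2) (by rw [Real.dist_eq, sub_zero, abs_of_pos (by positivity)]; linarith)
  convert this using 1
  simp only [f, AffineMap.lineMap_apply, vsub_eq_sub, vadd_eq_add, add_smul, one_smul]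
  abel

/-! ### The trace norm and trace balls. -/

section Operators

variable {H : Type*} [NormedAddCommGroup H] [InnerProductSpace ℂ H] [FiniteDimensional ℂ H]
  [CompleteSpace H]

local notation "ι" => Fin (Module.finrank ℂ H)

/-- Uniqueness of the positive square root, checked on basis vectors. -/
lemma abs_diagOp (b : OrthonormalBasis ι ℂ H) (p : ι → ℝ) :
    CFC.abs (diagOp b p) = diagOp b fun i => |p i| := by
  unfold CFC.abs
  refine CFC.sqrt_unique ?_ ((ContinuousLinearMap.nonneg_iff_isPositive _).2
    (diagOp_isPositive b fun i => abs_nonneg _))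
  have hsa : IsSelfAdjoint (diagOp b p) :=
    ContinuousLinearMap.isSelfAdjoint_iff_isSymmetric.2 (diagOp_isSymmetric b p)
  rw [hsa.star_eq]
  refine b.ext_continuousLinearMap fun i => ?_
  rw [mul_apply_eq_comp, mul_apply_eq_comp, diagOp_apply_self,
    diagOp_apply_self, map_smul, map_smul, diagOp_apply_self, diagOp_apply_self, smul_smul,
    smul_smul, ← Complex.ofReal_mul, ← Complex.ofReal_mul, abs_mul_abs_self]

/-- The trace norm `tr |A|`. -/
def traceNorm (A : H →L[ℂ] H) : ℝ :=
  (LinearMap.trace ℂ H ((CFC.abs A : H →L[ℂ] H) : H →ₗ[ℂ] H)).re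

lemma traceDist_eq (A B : H →L[ℂ] H) : traceDist A B = 1 / 2 * traceNorm (A - B) := rfl

lemma traceNorm_diagOp (b : OrthonormalBasis ι ℂ H) (p : ι → ℝ) :
    traceNorm (diagOp b p) = ∑ i, |p i| := by
  rw [traceNorm, abs_diagOp, trace_diagOp, Complex.ofReal_re]

lemma traceDist_diagOp (b : OrthonormalBasis ι ℂ H) (p q : ι → ℝ) :
    traceDist (diagOp b p) (diagOp b q) = 1 / 2 * ∑ i, |p i - q i| := by
  rw [traceDist_eq, diagOp_sub, traceNorm_diagOp]

/-- Diagonal entries are averages of the eigenvalues, so the triangle inequality bounds them by the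
diagonal of `|A|`. As an eigenbasis attains equality, the trace norm is a maximum over orthonormal
bases, which makes it subadditive. -/
lemma sum_abs_inner_le_traceNorm (c : OrthonormalBasis ι ℂ H) {A : H →L[ℂ] H}
    (hA : (A : H →ₗ[ℂ] H).IsSymmetric) :
    ∑ i, |(inner ℂ (c i) (A (c i))).re| ≤ traceNorm A := by
  have hb := (chosenEigenbasis_isSorted hA).eq_diagOp
  generalize chosenEigenbasis A = b at hb
  generalize eigVec A = p at hb
  subst hb
  rw [traceNorm, abs_diagOp, LinearMap.trace_eq_sum_inner _ c, Complex.re_sum]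
  refine sum_le_sum fun i _ => ?_
  rw [ContinuousLinearMap.coe_coe, inner_diagOp, inner_diagOp, Complex.ofReal_re,
    Complex.ofReal_re]
  refine (abs_sum_le_sum_abs _ _).trans (le_of_eq (sum_congr rfl fun j _ => ?_))
  rw [abs_mul, abs_of_nonneg (sq_nonneg ‖_‖)]

lemma exists_sum_abs_inner_eq_traceNorm {A : H →L[ℂ] H} (hA : (A : H →ₗ[ℂ] H).IsSymmetric) :
    ∃ c : OrthonormalBasis ι ℂ H, ∑ i, |(inner ℂ (c i) (A (c i))).re| = traceNorm A := by
  have hb := (chosenEigenbasis_isSorted hA).eq_diagOp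
  generalize chosenEigenbasis A = b at hb
  generalize eigVec A = p at hb
  subst hb
  refine ⟨b, ?_⟩
  rw [traceNorm_diagOp]
  refine sum_congr rfl fun i _ => ?_
  rw [diagOp_apply_self, inner_smul_right, b.inner_eq_one, mul_one, Complex.ofReal_re]

lemma traceNorm_add_le {A B : H →L[ℂ] H} (hA : (A : H →ₗ[ℂ] H).IsSymmetric)
    (hB : (B : H →ₗ[ℂ] H).IsSymmetric) : traceNorm (A + B) ≤ traceNorm A + traceNorm B := by
  obtain ⟨c, hc⟩ := exists_sum_abs_inner_eq_traceNorm (A := A + B) (by simpa using hA.add hB)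
  rw [← hc]
  refine le_trans ?_ (add_le_add (sum_abs_inner_le_traceNorm c hA) (sum_abs_inner_le_traceNorm c hB))
  rw [← sum_add_distrib]
  refine sum_le_sum fun i _ => ?_
  rw [add_apply, inner_add_right, Complex.add_re]
  exact abs_add_le _ _

omit [FiniteDimensional ℂ H] [CompleteSpace H] in
lemma real_smul_eq (r : ℝ) (A : H →L[ℂ] H) : r • A = (r : ℂ) • A := by
  ext x
  exact (Complex.coe_smul r (A x)).symm

lemma traceNorm_smul (r : ℝ) (A : H →L[ℂ] H) : traceNorm (r • A) = |r| * traceNorm A := by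
  unfold traceNorm
  rw [CFC.abs_smul r A, real_smul_eq, ContinuousLinearMap.toLinearMap_smul, map_smul, smul_eq_mul,
    Complex.re_ofReal_mul, Real.norm_eq_abs]

lemma isSymmetric_smul (r : ℝ) {A : H →L[ℂ] H} (hA : (A : H →ₗ[ℂ] H).IsSymmetric) :
    ((r • A : H →L[ℂ] H) : H →ₗ[ℂ] H).IsSymmetric := by
  rw [real_smul_eq]
  exact hA.smul (Complex.conj_ofReal r)

lemma isQState_convexComb {A B : H →L[ℂ] H} (hA : IsQState A) (hB : IsQState B) {s t : ℝ}
    (hs : 0 ≤ s) (ht : 0 ≤ t) (hst : s + t = 1) : IsQState (s • A + t • B) := by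
  rw [real_smul_eq, real_smul_eq]
  refine ⟨(hA.1.smul_of_nonneg (by exact_mod_cast hs)).add
    (hB.1.smul_of_nonneg (by exact_mod_cast ht)), ?_⟩
  rw [ContinuousLinearMap.toLinearMap_add, map_add, ContinuousLinearMap.toLinearMap_smul,
    ContinuousLinearMap.toLinearMap_smul, map_smul, map_smul, hA.2, hB.2]
  simp only [smul_eq_mul, mul_one]
  exact_mod_cast hst

lemma convex_traceBall {σ : H →L[ℂ] H} (hσ : IsQState σ) (ε : ℝ) :
    Convex ℝ (traceBall ε σ) := by
  intro A hA B hB s t hs ht hst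
  refine ⟨isQState_convexComb hA.1 hB.1 hs ht hst, ?_⟩
  have e : s • A + t • B - σ = s • (A - σ) + t • (B - σ) := by
    rw [smul_sub, smul_sub]
    nth_rw 1 [← one_smul ℝ σ, ← hst]
    rw [add_smul]
    abel
  have hA' : ((A - σ : H →L[ℂ] H) : H →ₗ[ℂ] H).IsSymmetric := hA.1.1.isSymmetric.sub hσ.1.isSymmetric
  have hB' : ((B - σ : H →L[ℂ] H) : H →ₗ[ℂ] H).IsSymmetric := hB.1.1.isSymmetric.sub hσ.1.isSymmetric
  have h := traceNorm_add_le (isSymmetric_smul s hA') (isSymmetric_smul t hB')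
  rw [traceNorm_smul, traceNorm_smul, abs_of_nonneg hs, abs_of_nonneg ht] at h
  have h1 := hA.2
  have h2 := hB.2
  rw [traceDist_eq] at h1 h2 ⊢
  rw [e]
  have h3 := mul_le_mul_of_nonneg_left h1 hs
  have h4 := mul_le_mul_of_nonneg_left h2 ht
  have h5 : s * ε + t * ε = ε := by rw [← add_mul, hst, one_mul]
  linarith

/-- The prefix sums of the ordered eigenvalues of two states differ by at most the trace
distance. -/
lemma sum_prefix_eigVec_sub_le {A B : H →L[ℂ] H} (hA : IsQState A) (hB : IsQState B) (k : ℕ) :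
    ∑ i with ((i : ι) : ℕ) < k, eigVec A i ≤
      ∑ i with ((i : ι) : ℕ) < k, eigVec B i + traceDist A B := by
  have hc := chosenEigenbasis_isSorted hA.1.isSymmetric
  have hd := (chosenEigenbasis_isSorted hB.1.isSymmetric).eq_diagOp
  set c := chosenEigenbasis A
  have hKF := sum_prefix_inner_diagOp_le (chosenEigenbasis B) c (eigVec_antitone B) k
  rw [← hd] at hKF
  set z : ι → ℝ := fun i => (inner ℂ (c i) ((A - B) (c i))).re with hz
  have e : ∀ i, eigVec A i = (inner ℂ (c i) (B (c i))).re + z i := by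
    intro i
    simp only [hz, sub_apply, inner_sub_right, Complex.sub_re]
    rw [hc i, inner_smul_right, c.inner_eq_one, mul_one, Complex.ofReal_re]
    ring
  have hz0 : ∑ i, z i = 0 := by
    have : LinearMap.trace ℂ H ((A - B : H →L[ℂ] H) : H →ₗ[ℂ] H) = 0 := by
      rw [ContinuousLinearMap.toLinearMap_sub, map_sub, hA.2, hB.2, sub_self]
    rw [LinearMap.trace_eq_sum_inner _ c] at this
    have := congr_arg Complex.re this
    rwa [Complex.re_sum] at this
  have hT := sum_abs_inner_le_traceNorm c (A := A - B) (hA.1.isSymmetric.sub hB.1.isSymmetric)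
  -- Since `z` has total zero, twice a prefix sum is the prefix minus its complement.
  have hpre : 2 * ∑ i with ((i : ι) : ℕ) < k, z i ≤ ∑ i, |z i| := by
    have h1 := sum_filter_add_sum_filter_not univ (fun i : ι => (i : ℕ) < k) z
    have h2 := sum_filter_add_sum_filter_not univ (fun i : ι => (i : ℕ) < k) fun i => |z i|
    have h3 : ∑ i with ((i : ι) : ℕ) < k, z i ≤ ∑ i with ((i : ι) : ℕ) < k, |z i| :=
      sum_le_sum fun i _ => le_abs_self _
    have h4 : -∑ i with ¬ ((i : ι) : ℕ) < k, z i ≤ ∑ i with ¬ ((i : ι) : ℕ) < k, |z i| := by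
      rw [← sum_neg_distrib]
      exact sum_le_sum fun i _ => neg_le_abs _
    linarith
  rw [traceDist_eq, sum_congr rfl fun i _ => e i, sum_add_distrib]
  linarith

lemma traceDist_comm (A B : H →L[ℂ] H) : traceDist A B = traceDist B A := by
  rw [traceDist, traceDist, ← CFC.abs_neg (A - B), neg_sub]

lemma traceDist_mixedState {σ : H →L[ℂ] H} (hσ : IsQState σ) :
    traceDist σ (mixedState H) = deficit (eigVec σ) (Module.finrank ℂ H : ℝ)⁻¹ := by
  have hb := (chosenEigenbasis_isSorted hσ.1.isSymmetric).eq_diagOp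
  conv_lhs => rw [hb, mixedState_eq_diagOp (chosenEigenbasis σ)]
  rw [traceDist_diagOp, sum_abs_sub_inv_card hσ.sum_eigVec]
  ring

lemma minStateIn_eq {σ : H →L[ℂ] H} (hσ : IsQState σ) (ε : ℝ) (b : OrthonormalBasis ι ℂ H) :
    minStateIn ε σ b = diagOp b (minVec (eigVec σ) ε) := by
  unfold minStateIn minVec
  rw [traceDist_mixedState hσ]
  split_ifs
  · rfl
  · exact mixedState_eq_diagOp b

/-- Lets every later computation take place in the given eigenbasis instead of the chosen one. -/
lemma minState_eq {σ : H →L[ℂ] H} (hσ : IsQState σ) {ε : ℝ} (hε : 0 < ε)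
    {b : OrthonormalBasis ι ℂ H} (hb : IsSortedEigenbasis σ b) :
    minState ε σ = diagOp b (minVec (eigVec σ) ε) := by
  rw [minState, minStateIn_eq hσ]
  exact diagOp_comp_eq (chosenEigenbasis_isSorted hσ.1.isSymmetric) hb
    (minVec_facts (eigVec_antitone σ) hσ.eigVec_nonneg hσ.sum_eigVec hε).2.2.2.2.2.2.1

/-- States with the same eigenvalues are unitarily equivalent. -/
lemma exists_unitary_conj_of_eigVec_eq {A : H →L[ℂ] H} (hA : (A : H →ₗ[ℂ] H).IsSymmetric)
    (b : OrthonormalBasis ι ℂ H) {p : ι → ℝ} (h : eigVec A = p) :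
    ∃ U ∈ unitary (H →L[ℂ] H), A = U * diagOp b p * star U := by
  have hc := chosenEigenbasis_isSorted hA
  set c := chosenEigenbasis A
  let u : unitary (H →L[ℂ] H) := Unitary.linearIsometryEquiv.symm (b.equiv c (Equiv.refl _))
  have hu : ∀ i, (u : H →L[ℂ] H) (b i) = c i := by
    intro i
    simp [u]
  refine ⟨u, u.2, ?_⟩
  have key : A * (u : H →L[ℂ] H) = u * diagOp b p := by
    refine b.ext_continuousLinearMap fun i => ?_
    rw [mul_apply_eq_comp, mul_apply_eq_comp, hu, hc i, diagOp_apply_self,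
      map_smul, hu, h]
  rw [← key, mul_assoc, Unitary.mul_star_self_of_mem u.2, mul_one]

/-- A state with the same eigenvalues as a majorization-minimal element of a trace ball coincides
with it. -/
lemma eq_of_eigVec_eq_of_opMajorizedBy {σ ρ ρ' : H →L[ℂ] H} (hσ : IsQState σ) {ε : ℝ}
    (hρ : ρ ∈ traceBall ε σ) (hρ' : ρ' ∈ traceBall ε σ)
    (hmin : ∀ ω ∈ traceBall ε σ, opMajorizedBy ρ' ω) (h : eigVec ρ = eigVec ρ') : ρ = ρ' := by
  -- The midpoint stays in the ball, so minimality of `ρ'` keeps its sum of squared eigenvalues from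
  -- falling below that of `ρ'`; the parallelogram law then leaves no room for `ρ - ρ'`.
  set ω : H →L[ℂ] H := (1 / 2 : ℝ) • ρ + (1 / 2 : ℝ) • ρ' with hω
  have hωB : ω ∈ traceBall ε σ :=
    convex_traceBall hσ ε hρ hρ' (by norm_num) (by norm_num) (by norm_num)
  obtain ⟨h1, h2⟩ := (opMajorizedBy_iff _ _).1 (hmin ω hωB)
  have hsq := sum_sq_le_of_sum_prefix_le (eigVec_antitone ρ') h1 h2
  have b := stdOrthonormalBasis ℂ H
  have n1 := sum_norm_sq_apply b hρ.1.1.isSymmetric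
  have n2 := sum_norm_sq_apply b hρ'.1.1.isSymmetric
  have n3 := sum_norm_sq_apply b hωB.1.1.isSymmetric
  rw [h] at n1
  have par : ∀ i, ‖ρ (b i) - ρ' (b i)‖ ^ 2 =
      2 * ‖ρ (b i)‖ ^ 2 + 2 * ‖ρ' (b i)‖ ^ 2 - 4 * ‖ω (b i)‖ ^ 2 := by
    intro i
    have e : ω (b i) = (1 / 2 : ℂ) • (ρ (b i) + ρ' (b i)) := by
      rw [hω, real_smul_eq, real_smul_eq, ← smul_add]
      simp
    have := parallelogram_law_with_norm ℂ (ρ (b i)) (ρ' (b i))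
    rw [e, norm_smul, mul_pow]
    norm_num
    linarith
  have hsum : ∑ i, ‖ρ (b i) - ρ' (b i)‖ ^ 2 ≤ 0 := by
    rw [sum_congr rfl fun i _ => par i, sum_sub_distrib, sum_add_distrib, ← mul_sum, ← mul_sum,
      ← mul_sum, n1, n2, n3]
    linarith
  refine b.ext_continuousLinearMap fun i => ?_
  have := (sum_eq_zero_iff_of_nonneg fun i _ => sq_nonneg _).1
    (le_antisymm hsum (sum_nonneg fun i _ => sq_nonneg _)) i (mem_univ i)
  exact sub_eq_zero.1 (norm_eq_zero.1 (pow_eq_zero_iff two_ne_zero |>.1 this))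

lemma self_mem_traceBall {σ : H →L[ℂ] H} (hσ : IsQState σ) {ε : ℝ} (hε : 0 ≤ ε) :
    σ ∈ traceBall ε σ := by
  refine ⟨hσ, ?_⟩
  rw [traceDist, sub_self, CFC.abs_zero]
  simpa using hε

/-- A state at distance exactly `ε` from the center lies on the boundary of the trace ball. -/
lemma mem_intrinsicFrontier_of_traceDist_eq {σ ρ : H →L[ℂ] H} (hσ : IsQState σ) (hρ : IsQState ρ)
    {ε : ℝ} (hε : 0 < ε) (h : traceDist ρ σ = ε) : ρ ∈ intrinsicFrontier ℝ (traceBall ε σ) := by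
  refine mem_intrinsicFrontier_of_forall_notMem ⟨hρ, h.le⟩ (self_mem_traceBall hσ hε.le)
    fun t ht hmem => ?_
  have h1 := hmem.2
  -- Prolonging the segment from the center multiplies the distance by `1 + t`.
  have e : ρ + t • (ρ - σ) - σ = (1 + t) • (ρ - σ) := by
    rw [add_smul, one_smul]
    abel
  rw [traceDist_eq, e, traceNorm_smul, abs_of_pos (by linarith)] at h1
  rw [traceDist_eq] at h
  nlinarith

/-- In dimension at least two, a pure state in a trace ball of positive radius lies on its
boundary. -/
lemma mem_intrinsicFrontier_of_apply_eq_zero {σ ρ : H →L[ℂ] H} (hσ : IsQState σ) {ε : ℝ}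
    (hε0 : 0 < ε) (hε1 : ε ≤ 1) (hρ : ρ ∈ traceBall ε σ) {w : H} (hw : w ≠ 0) (hρw : ρ w = 0) :
    ρ ∈ intrinsicFrontier ℝ (traceBall ε σ) := by
  have hb := (chosenEigenbasis_isSorted hσ.1.isSymmetric).eq_diagOp
  set b := chosenEigenbasis σ
  have hd := pos_of_sum_eq_one hσ.sum_eigVec
  set t : ℝ := (Module.finrank ℂ H : ℝ)⁻¹ with ht
  have ht0 : 0 < t := by positivity
  have hτ : IsQState (mixedState H) := by
    rw [mixedState_eq_diagOp b]
    exact isQState_diagOp b (fun _ => ht0.le) (sum_inv_card hd)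
  have hdist : traceNorm (mixedState H - σ) ≤ 2 := by
    have h1 := traceDist_mixedState hσ
    rw [traceDist_comm, traceDist_eq] at h1
    have h2 : deficit (eigVec σ) t ≤ 1 := by
      rw [← sum_inv_card hd]
      exact sum_le_sum fun i _ => max_le (by linarith [hσ.eigVec_nonneg i]) ht0.le
    linarith
  -- A positive definite point of the ball: the weight `ε` on `τ` suffices because `τ` is at trace
  -- distance at most `1` from `σ`. Only a kernel vector of `ρ` is used below, not purity:
  -- prolonging past `ρ` makes the quadratic form at `w` negative.
  set y : H →L[ℂ] H := (1 - ε) • σ + ε • mixedState H with hy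
  have hyB : y ∈ traceBall ε σ := by
    refine ⟨isQState_convexComb hσ hτ (by linarith) hε0.le (by ring), ?_⟩
    have e : y - σ = ε • (mixedState H - σ) := by
      rw [hy, sub_smul, one_smul, smul_sub]
      abel
    rw [traceDist_eq, e, traceNorm_smul, abs_of_pos hε0]
    nlinarith
  refine mem_intrinsicFrontier_of_forall_notMem hρ hyB fun s hs hmem => ?_
  have hpos := hmem.1.1.re_inner_nonneg_right w
  have hσw := hσ.1.re_inner_nonneg_right w
  have hτw : (mixedState H) w = (t : ℂ) • w := by simp [mixedState, ht]
  have hyw : y w = ((1 - ε : ℝ) : ℂ) • σ w + (ε : ℂ) • (t : ℂ) • w := by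
    rw [hy, real_smul_eq, real_smul_eq, ← hτw]
    rfl
  have hval : (ρ + s • (ρ - y)) w = -((s : ℂ) • y w) := by
    rw [real_smul_eq, add_apply, smul_apply, sub_apply, hρw]
    simp
  rw [hval, hyw, inner_neg_right, inner_smul_right, inner_add_right, inner_smul_right,
    inner_smul_right, inner_smul_right, inner_self_eq_norm_sq_to_K] at hpos
  simp only [RCLike.re_eq_complex_re] at hpos hσw
  have e2 : (-((s : ℂ) * (((1 - ε : ℝ) : ℂ) * inner ℂ w (σ w) +
      (ε : ℂ) * ((t : ℂ) * ((‖w‖ : ℝ) : ℂ) ^ 2)))).re =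
      -(s * ((1 - ε) * (inner ℂ w (σ w)).re + ε * (t * ‖w‖ ^ 2))) := by
    rw [Complex.neg_re, Complex.re_ofReal_mul, Complex.add_re, Complex.re_ofReal_mul,
      Complex.re_ofReal_mul, Complex.re_ofReal_mul, ← Complex.ofReal_pow, Complex.ofReal_re]
  have h3 : 0 < ‖w‖ := norm_pos_iff.2 hw
  have h4 : 0 < ε * (t * ‖w‖ ^ 2) := by positivity
  have h5 : 0 ≤ (1 - ε) * (inner ℂ w (σ w)).re := mul_nonneg (by linarith) hσw
  have h6 : 0 < s * ((1 - ε) * (inner ℂ w (σ w)).re + ε * (t * ‖w‖ ^ 2)) :=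
    mul_pos hs (by linarith)
  have h7 := hpos.trans_eq e2
  linarith

end Operators

end

/-! ### Assembly of the theorem. -/

theorem theorem3p1 {H : Type*} [NormedAddCommGroup H] [InnerProductSpace ℂ H]
    [FiniteDimensional ℂ H] [CompleteSpace H]
    (σ : H →L[ℂ] H) (hσ : IsQState σ) (ε : ℝ) (hε0 : 0 < ε) (hε1 : ε ≤ 1)
    (b : OrthonormalBasis (Fin (Module.finrank ℂ H)) ℂ H) (hb : IsSortedEigenbasis σ b) :
    -- the construction of `ρ*_ε(σ)` makes sense and does not depend on the eigenbasis
    (ε < traceDist σ (mixedState H) →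
      (∃! a : ℝ × ℕ, IsLowLevel (eigVec σ) ε a) ∧ (∃! a : ℝ × ℕ, IsHighLevel (eigVec σ) ε a)) ∧
    minStateIn ε σ b = minState ε σ ∧
    -- both states lie in the ball and are extremal there
    minState ε σ ∈ traceBall ε σ ∧
    maxStateIn ε σ b ∈ traceBall ε σ ∧
    (∀ ω ∈ traceBall ε σ,
      opMajorizedBy (minState ε σ) ω ∧ opMajorizedBy ω (maxStateIn ε σ b)) ∧
    -- uniqueness
    (∀ ρ ∈ traceBall ε σ, (∀ ω ∈ traceBall ε σ, opMajorizedBy ρ ω) → ρ = minState ε σ) ∧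
    (∀ ρ ∈ traceBall ε σ, (∀ ω ∈ traceBall ε σ, opMajorizedBy ω ρ) →
      ∃ U ∈ unitary (H →L[ℂ] H), ρ = U * maxStateIn ε σ b * star U) ∧
    -- boundary
    (2 ≤ Module.finrank ℂ H → maxStateIn ε σ b ∈ intrinsicFrontier ℝ (traceBall ε σ)) ∧
    (traceDist (maxStateIn ε σ b) σ = ε ∨
      ∃ v : H, ‖v‖ = 1 ∧ maxStateIn ε σ b = InnerProductSpace.rankOne ℂ v v) ∧
    (minState ε σ = mixedState H ∨
      (traceDist (minState ε σ) σ = ε ∧ minState ε σ ∈ intrinsicFrontier ℝ (traceBall ε σ))) ∧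
    -- semigroup law
    (∀ ε₁ ε₂ : ℝ, 0 < ε₁ → ε₁ ≤ 1 → 0 < ε₂ → ε₂ ≤ 1 →
      minState (ε₁ + ε₂) σ = minState ε₁ (minState ε₂ σ)) ∧
    -- equality in the triangle inequality
    traceDist σ (mixedState H) =
      traceDist (mixedState H) (minState ε σ) + traceDist (minState ε σ) σ := by
  have hanti := eigVec_antitone σ
  have h0 := hσ.eigVec_nonneg
  have hs := hσ.sum_eigVec
  have hd := pos_of_sum_eq_one hs
  have hσb := hb.eq_diagOp
  have hmin := minState_eq hσ hε0 hb
  obtain ⟨pa, p0, ps, pd, pe, pt, -, pmaj⟩ := minVec_facts hanti h0 hs hε0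
  obtain ⟨qa, q0, qs, qd, -⟩ := spreadVec_facts hanti h0 hs hε0
  have dist_eq : ∀ p, traceDist (diagOp b p) σ = 1 / 2 * ∑ i, |p i - eigVec σ i| := fun p => by
    conv_lhs => rw [hσb]
    exact traceDist_diagOp b p _
  have hminB : minState ε σ ∈ traceBall ε σ := by
    rw [hmin]
    exact ⟨isQState_diagOp b p0 ps, by rw [dist_eq]; linarith⟩
  have hmaxB : maxStateIn ε σ b ∈ traceBall ε σ := by
    refine ⟨isQState_diagOp b q0 qs, ?_⟩
    rw [maxStateIn, dist_eq]
    rcases qd with ⟨qd, -⟩ | qd <;> linarith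
  have hmaj : ∀ ω ∈ traceBall ε σ,
      opMajorizedBy (minState ε σ) ω ∧ opMajorizedBy ω (maxStateIn ε σ b) := by
    rintro ω ⟨hω, hωd⟩
    constructor
    · rw [opMajorizedBy_iff, hmin, eigVec_diagOp b pa]
      refine ⟨pmaj _ (eigVec_antitone ω) hω.sum_eigVec fun k => ?_, ps.trans hω.sum_eigVec.symm⟩
      have := sum_prefix_eigVec_sub_le hσ hω k
      rw [traceDist_comm] at this
      linarith
    · rw [opMajorizedBy_iff, maxStateIn, eigVec_diagOp b qa]
      refine ⟨sum_prefix_le_spreadVec hanti h0 hs hε0 hω.eigVec_nonneg hω.sum_eigVec fun k => ?_,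
        hω.sum_eigVec.trans qs.symm⟩
      have := sum_prefix_eigVec_sub_le hω hσ k
      linarith
  refine ⟨fun h => ?_, ?_, hminB, hmaxB, hmaj, fun ρ hρ h => ?_, fun ρ hρ h => ?_, fun h2 => ?_,
    ?_, ?_, fun ε₁ ε₂ hε₁ _ hε₂ _ => ?_, ?_⟩
  · rw [traceDist_mixedState hσ] at h
    exact ⟨existsUnique_isLowLevel hanti h0 hs hε0 h, existsUnique_isHighLevel hanti h0 hs hε0 h⟩
  · rw [hmin, minStateIn_eq hσ]
  · exact eq_of_eigVec_eq_of_opMajorizedBy hσ hρ hminB (fun ω hω => (hmaj ω hω).1)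
      (eigVec_eq_of_opMajorizedBy (h _ hminB) (hmaj ρ hρ).1)
  · have e := eigVec_eq_of_opMajorizedBy (hmaj ρ hρ).2 (h _ hmaxB)
    rw [maxStateIn, eigVec_diagOp b qa] at e
    exact exists_unitary_conj_of_eigVec_eq hρ.1.1.isSymmetric b e
  · rcases qd with ⟨-, qd⟩ | qd
    -- In the pure case the second basis vector, which exists because the dimension is at least two,
    -- lies in the kernel.
    · refine mem_intrinsicFrontier_of_apply_eq_zero hσ hε0 hε1 hmaxB (w := b ⟨1, h2⟩)
        (b.orthonormal.ne_zero _) ?_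
      rw [maxStateIn, diagOp_apply_self, qd]
      simp
    · exact mem_intrinsicFrontier_of_traceDist_eq hσ hmaxB.1 hε0
        (by rw [maxStateIn, dist_eq, qd]; ring)
  · rcases qd with ⟨-, qd⟩ | qd
    · refine Or.inr ⟨b ⟨0, hd⟩, b.norm_eq_one _, ?_⟩
      refine (eq_diagOp b fun i => ?_).symm
      rw [InnerProductSpace.rankOne_apply, b.inner_eq_ite, qd]
      by_cases hi : (i : ℕ) = 0
      · obtain rfl : i = ⟨0, hd⟩ := Fin.ext hi
        simp
      · rw [if_neg fun h => hi (congr_arg Fin.val h.symm), if_neg hi]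
        simp
    · exact Or.inl (by rw [maxStateIn, dist_eq, qd]; ring)
  · refine pe.imp (fun e => ?_) fun e => ?_
    · rw [hmin, e, mixedState_eq_diagOp b]
    · have hdist : traceDist (minState ε σ) σ = ε := by rw [hmin, dist_eq, e]; ring
      exact ⟨hdist, mem_intrinsicFrontier_of_traceDist_eq hσ hminB.1 hε0 hdist⟩
  · obtain ⟨ra, r0, rs, -⟩ := minVec_facts hanti h0 hs hε₂
    -- The inner state is diagonal in `b` with non-increasing entries, so `b` is again a sorted
    -- eigenbasis and the law reduces to vectors.
    rw [minState_eq hσ (add_pos hε₁ hε₂) hb, minState_eq hσ hε₂ hb,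
      minState_eq (isQState_diagOp b r0 rs) hε₁ (isSortedEigenbasis_diagOp b ra),
      eigVec_diagOp b ra, minVec_add hanti h0 hs hε₁ hε₂]
  · rw [hmin, dist_eq, mixedState_eq_diagOp b, traceDist_diagOp]
    conv_lhs => rw [hσb]
    rw [traceDist_diagOp, pt]
    ring
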